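/- Let $M$ be a (Hausdorff, finite-dimensional) smooth manifold without boundary and let $\mathfrak g\to M$ be a smooth real vector bundle of finite rank; $\Gamma(\cdot)$ denotes smooth sections. A *Lie algebroid* structure on $\mathfrak g$ is a vector bundle morphism $\#:\mathfrak g\to TM$ (the anchor) together with an $\mathbb R$-linear Lie bracket $[\cdot,\cdot]$ on $\Gamma(\mathfrak g)$ such that $\#[X,Y]=[\#X,\#Y]_{TM}$ and $[X,fY]=f[X,Y]+df(\#X)\,Y$ for all $X,Y\in\Gamma(\mathfrak g)$, $f\in C^\infty(M)$. A *Cartan algebroid* $(\mathfrak g,\nabla)$ on $M$ is a Lie algebroid $\mathfrak g$ with a smooth affine connection $\nabla$ on $\mathfrak g$ satisfying $$\nabla_V[X,Y]=[\nabla_VX,Y]+[X,\nabla_VY]+\nabla_{\bar\nabla_YV}X-\nabla_{\bar\nabla_XV}Y,\qquad \bar\nabla_XV:=\#\nabla_VX+[\#X,V]_{TM},$$ for all $X,Y\in\Gamma(\mathfrak g)$, $V\in\Gamma(TM)$. An isomorphism of Cartan algebroids is an isomorphism of vector bundles covering the identity that respects anchors, brackets and connections. Given a smooth action of a finite-dimensional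 real Lie algebra $\mathfrak g_0$ on a manifold $U$, i.e. a Lie algebra homomorphism $\mathfrak g_0\to\Gamma(TU)$, the *action algebroid* is the trivial bundle $\mathfrak g_0\times U$ with the action map $\#:\mathfrak g_0\times U\to TU$ as anchor, and with the bracket $[X,Y]=\nabla^0_{\#X}Y-\nabla^0_{\#Y}X+\tau(X,Y)$, where $\nabla^0$ is the canonical flat connection and $\tau(X,Y)(m)=[X(m),Y(m)]_{\mathfrak g_0}$. A Cartan algebroid is *symmetric* if it is isomorphic to some action algebroid with its canonical flat connection $\nabla^0$. It is *locally symmetric* if every point of $M$ has an open neighbourhood $U$ such that the restriction $(\mathfrak g,\nabla)|_U$ is symmetric. **Theorem A.** Let $(\mathfrak g,\nabla)$ be a Cartan algebroid on $M$. 1. $(\mathfrak g,\nabla)$ is locally symmetric if and only if $\nabla$ is flat. 2. If $M$ is simply connected and $(\mathfrak g,\nabla)$ is locally symmetric, then $(\mathfrak g,\nabla)$ is symmetric. More precisely, the Lie algebra $\mathfrak g_0\subset\Gamma(\mathfrak g)$ of $\nabla$-parallel sections is finite-dimensional, and the map $\mathfrak g_0\times M\to\mathfrak g$, $(X,m)\mapsto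 X(m)$, is an isomorphism of Cartan algebroids from the action algebroid of the action $X\mapsto\#X$ of $\mathfrak g_0$ on $M$, with its canonical flat connection, onto $(\mathfrak g,\nabla)$. -/

import Mathlib

open scoped Manifold ContDiff Bundle Topology
open Bundle VectorField

noncomputable section

/-! ## Sections of vector bundles over a smooth manifold -/

section Sections

variable {E : Type*} [NormedAddCommGroup E] [NormedSpace ℝ E]
  {M : Type*} [TopologicalSpace M] [ChartedSpace E M]
  {F : Type*} [NormedAddCommGroup F] [NormedSpace ℝ F]
  {V : M → Type*} [TopologicalSpace (TotalSpace F V)] [∀ x, TopologicalSpace (V x)]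
  [FiberBundle F V] [∀ x, AddCommGroup (V x)] [∀ x, Module ℝ (V x)] [VectorBundle ℝ F V]

/-- The product `f X` of a smooth function and a smooth section. -/
def smoothFunSmul (f : C^∞⟮𝓘(ℝ, E), M; ℝ⟯) (X : Cₛ^∞⟮𝓘(ℝ, E); F, V⟯) :
    Cₛ^∞⟮𝓘(ℝ, E); F, V⟯ :=
  ⟨fun x => f x • X x, ContMDiff.smul_section f.contMDiff X.contMDiff⟩

variable (E M) in
/-- Smooth vector fields on `M`. -/
abbrev SmoothVectorField [IsManifold 𝓘(ℝ, E) ∞ M] :=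
  Cₛ^∞⟮𝓘(ℝ, E); E, (TangentSpace 𝓘(ℝ, E) : M → Type _)⟯

/-- The Jacobi-Lie bracket of smooth vector fields. -/
def SmoothVectorField.lie [IsManifold 𝓘(ℝ, E) ∞ M] [CompleteSpace E]
    (U W : SmoothVectorField E M) : SmoothVectorField E M :=
  ⟨fun x => mlieBracket 𝓘(ℝ, E) U W x, fun x =>
    haveI : IsManifold 𝓘(ℝ, E) (((⊤ : ℕ∞) : ℕ∞ω) + 1) M :=
      inferInstanceAs (IsManifold 𝓘(ℝ, E) ∞ M)
    haveI : IsManifold 𝓘(ℝ, E) (minSmoothness ℝ 2) M := by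
      rw [minSmoothness_of_isRCLikeNormedField]; infer_instance
    haveI : IsManifold 𝓘(ℝ, E) (minSmoothness ℝ 3) M := by
      rw [minSmoothness_of_isRCLikeNormedField]; infer_instance
    ContMDiffAt.mlieBracket_vectorField (m := ⊤) (n := ⊤) (U.contMDiff x) (W.contMDiff x)
      (by simp)⟩

/-- A section which is smooth on an open set agrees near each point of that set with a global
smooth section. -/
theorem exists_contMDiffSection_eventuallyEq [FiniteDimensional ℝ E] [T2Space M]
    [IsManifold 𝓘(ℝ, E) ∞ M] {U : Set M} (hU : IsOpen U) {x : M} (hx : x ∈ U) {σ : Π x, V x}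
    (hσ : ContMDiffOn 𝓘(ℝ, E) (𝓘(ℝ, E).prod 𝓘(ℝ, F)) ∞
      (fun y => (⟨y, σ y⟩ : TotalSpace F V)) U) :
    ∃ X : Cₛ^∞⟮𝓘(ℝ, E); F, V⟯, ∀ᶠ y in 𝓝 x, X y = σ y := by
  obtain ⟨f, -, hf⟩ := (SmoothBumpFunction.nhds_basis_tsupport (I := 𝓘(ℝ, E)) x).mem_iff.1
    (hU.mem_nhds hx)
  refine ⟨⟨fun y => f y • σ y, ContMDiffOn.smul_section_of_tsupport f.contMDiff.contMDiffOn hU hf hσ⟩, ?_⟩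
  filter_upwards [f.eventuallyEq_one] with y hy
  simp [hy]

end Sections

/-! ## Lie algebroids -/

section Algebroids

variable (E : Type*) [NormedAddCommGroup E] [NormedSpace ℝ E] [FiniteDimensional ℝ E]
  {M : Type*} [TopologicalSpace M] [ChartedSpace E M] [IsManifold 𝓘(ℝ, E) ∞ M]
  (F : Type*) [NormedAddCommGroup F] [NormedSpace ℝ F] [FiniteDimensional ℝ F]
  (V : M → Type*) [TopologicalSpace (TotalSpace F V)] [∀ x, TopologicalSpace (V x)]
  [FiberBundle F V] [∀ x, AddCommGroup (V x)] [∀ x, Module ℝ (V x)] [VectorBundle ℝ F V]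
  [ContMDiffVectorBundle ∞ F V 𝓘(ℝ, E)]

/-- A Lie algebroid structure on the smooth vector bundle `V` over `M`: an anchor `V → TM` and a
real Lie bracket on the space of smooth sections, such that the anchor is a homomorphism into the
Lie algebra of vector fields and the Leibniz rule `[X, fY] = f[X, Y] + df(#X)Y` holds. -/
structure LieAlgebroid where
  /-- the anchor, a smooth morphism of vector bundles -/
  anchor : Cₛ^∞⟮𝓘(ℝ, E); F →L[ℝ] E, fun x : M => V x →L[ℝ] TangentSpace 𝓘(ℝ, E) x⟯
  /-- the bracket of smooth sections -/
  bracket : Cₛ^∞⟮𝓘(ℝ, E); F, V⟯ →ₗ[ℝ] Cₛ^∞⟮𝓘(ℝ, E); F, V⟯ →ₗ[ℝ] Cₛ^∞⟮𝓘(ℝ, E); F, V⟯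
  bracket_self : ∀ X, bracket X X = 0
  jacobi : ∀ X Y Z, bracket X (bracket Y Z) = bracket (bracket X Y) Z + bracket Y (bracket X Z)
  anchor_bracket : ∀ (X Y : Cₛ^∞⟮𝓘(ℝ, E); F, V⟯) (x : M), anchor x (bracket X Y x) =
    mlieBracket 𝓘(ℝ, E) (fun y => anchor y (X y)) (fun y => anchor y (Y y)) x
  leibniz : ∀ (X : Cₛ^∞⟮𝓘(ℝ, E); F, V⟯) (f : C^∞⟮𝓘(ℝ, E), M; ℝ⟯) (Y : Cₛ^∞⟮𝓘(ℝ, E); F, V⟯)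
    (x : M), bracket X (smoothFunSmul f Y) x =
      f x • bracket X Y x + mvfderiv 𝓘(ℝ, E) f x (anchor x (X x)) • Y x

variable {E F V}

namespace LieAlgebroid

variable (A : LieAlgebroid E F V)

/-- The vector field `#X`. -/
def anchorField (X : Cₛ^∞⟮𝓘(ℝ, E); F, V⟯) : SmoothVectorField E M :=
  ⟨fun x => A.anchor x (X x), ContMDiff.clm_bundle_apply A.anchor.contMDiff X.contMDiff⟩

theorem bracket_skew (X Y : Cₛ^∞⟮𝓘(ℝ, E); F, V⟯) : A.bracket X Y = -A.bracket Y X := by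
  have h := A.bracket_self (X + Y)
  simp only [map_add, LinearMap.add_apply, A.bracket_self, zero_add, add_zero] at h
  exact eq_neg_of_add_eq_zero_right h

/-- The bracket is local. -/
theorem bracket_congr [T2Space M] {X X' Y Y' : Cₛ^∞⟮𝓘(ℝ, E); F, V⟯} {x : M}
    (hX : ∀ᶠ y in 𝓝 x, X y = X' y) (hY : ∀ᶠ y in 𝓝 x, Y y = Y' y) :
    A.bracket X Y x = A.bracket X' Y' x := by
  have key : ∀ X Y : Cₛ^∞⟮𝓘(ℝ, E); F, V⟯, (∀ᶠ y in 𝓝 x, Y y = 0) → A.bracket X Y x = 0 := by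
    intro X Y h
    obtain ⟨f, -, hf⟩ :=
      (SmoothBumpFunction.nhds_basis_tsupport (I := 𝓘(ℝ, E)) x).mem_iff.1 h
    have h0 : smoothFunSmul ⟨f, f.contMDiff⟩ Y = 0 := by
      ext y
      by_cases hy : y ∈ tsupport f
      · have : Y y = 0 := hf hy
        simp [smoothFunSmul, this]
      · simp [smoothFunSmul, image_eq_zero_of_notMem_tsupport hy]
    have h1 := A.leibniz X ⟨f, f.contMDiff⟩ Y x
    rw [h0, map_zero, h.self_of_nhds] at h1
    simpa using h1.symm
  have h1 : A.bracket X (Y - Y') x = 0 := key _ _ (hY.mono fun y hy => by simp [hy])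
  have h2 : A.bracket Y' (X - X') x = 0 := key _ _ (hX.mono fun y hy => by simp [hy])
  have h3 : A.bracket (X - X') Y' x = 0 := by
    rw [A.bracket_skew, ContMDiffSection.coe_neg, Pi.neg_apply, h2, neg_zero]
  simp only [map_sub, LinearMap.sub_apply, ContMDiffSection.coe_sub, Pi.sub_apply,
    sub_eq_zero] at h1 h3
  rw [h1, h3]

open Classical in
/-- The bracket on local sections: if `X` and `Y` are smooth near `x`, then the value of their
bracket at `x` is that of any two global smooth sections with the same germs at `x`. On sections
over an open set `U` this is the bracket of the restricted Lie algebroid `A|_U`. -/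
def localBracket (X Y : Π x, V x) (x : M) : V x :=
  if h : ∃ p : Cₛ^∞⟮𝓘(ℝ, E); F, V⟯ × Cₛ^∞⟮𝓘(ℝ, E); F, V⟯,
      (∀ᶠ y in 𝓝 x, p.1 y = X y) ∧ (∀ᶠ y in 𝓝 x, p.2 y = Y y)
  then A.bracket h.choose.1 h.choose.2 x else 0

theorem localBracket_eq [T2Space M] {X Y : Π x, V x} {x : M} (X' Y' : Cₛ^∞⟮𝓘(ℝ, E); F, V⟯)
    (hX : ∀ᶠ y in 𝓝 x, X' y = X y) (hY : ∀ᶠ y in 𝓝 x, Y' y = Y y) :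
    A.localBracket X Y x = A.bracket X' Y' x := by
  have h : ∃ p : Cₛ^∞⟮𝓘(ℝ, E); F, V⟯ × Cₛ^∞⟮𝓘(ℝ, E); F, V⟯,
      (∀ᶠ y in 𝓝 x, p.1 y = X y) ∧ (∀ᶠ y in 𝓝 x, p.2 y = Y y) := ⟨(X', Y'), hX, hY⟩
  rw [localBracket, dif_pos h]
  apply A.bracket_congr
  · filter_upwards [h.choose_spec.1, hX] with y h1 h2 using h1.trans h2.symm
  · filter_upwards [h.choose_spec.2, hY] with y h1 h2 using h1.trans h2.symm

end LieAlgebroid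

/-! ## Cartan algebroids -/

section Connection

variable [∀ x, IsTopologicalAddGroup (V x)] [∀ x, ContinuousSMul ℝ (V x)]

/-- The smooth section `∇_U X`, for a smooth affine connection `∇`. -/
def covSection (conn : CovariantDerivative 𝓘(ℝ, E) F V)
    (hconn : CovariantDerivative.ContMDiffCovariantDerivative conn ∞)
    (U : SmoothVectorField E M) (X : Cₛ^∞⟮𝓘(ℝ, E); F, V⟯) : Cₛ^∞⟮𝓘(ℝ, E); F, V⟯ :=
  ⟨fun x => conn X x (U x), ContMDiff.clm_bundle_apply
    (contMDiffOn_univ.1 (hconn.contMDiff.contMDiff (σ := X) X.contMDiff.contMDiffOn))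
    U.contMDiff⟩

end Connection

variable [∀ x, IsTopologicalAddGroup (V x)] [∀ x, ContinuousSMul ℝ (V x)]

variable (E F V) in
/-- A Cartan algebroid structure on `V`: a Lie algebroid structure with a Cartan connection, i.e. a
smooth affine connection `∇` on `V` satisfying
`∇_U [X, Y] = [∇_U X, Y] + [X, ∇_U Y] + ∇_{∇̄_Y U} X - ∇_{∇̄_X U} Y`, where
`∇̄_X U = #(∇_U X) + [#X, U]`. -/
structure CartanAlgebroid extends LieAlgebroid E F V where
  /-- the connection; `conn X x u` is `(∇_u X)(x)` -/
  conn : CovariantDerivative 𝓘(ℝ, E) F V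
  smooth_conn : CovariantDerivative.ContMDiffCovariantDerivative conn ∞
  compat : ∀ (X Y : Cₛ^∞⟮𝓘(ℝ, E); F, V⟯) (U : SmoothVectorField E M),
    covSection conn smooth_conn U (bracket X Y) =
      bracket (covSection conn smooth_conn U X) Y + bracket X (covSection conn smooth_conn U Y)
      + covSection conn smooth_conn
          (toLieAlgebroid.anchorField (covSection conn smooth_conn U Y)
            + (toLieAlgebroid.anchorField Y).lie U) X
      - covSection conn smooth_conn
          (toLieAlgebroid.anchorField (covSection conn smooth_conn U X)
            + (toLieAlgebroid.anchorField X).lie U) Y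

/-! ## Lie algebra actions and action algebroids -/

section Action

variable (E)
variable (G : Type*) [LieRing G] [LieAlgebra ℝ G]

/-- A smooth action of a real Lie algebra `G` on the open set `U`: a homomorphism of `G` into the
Lie algebra of smooth vector fields on `U`. (For finite-dimensional `G` this is the same as
smoothness of the action map `G × U → TU`; values outside `U` are irrelevant.) -/
structure LieAlgebraActionOn (U : Set M) where
  /-- the vector field of an element of the Lie algebra -/
  field : G →ₗ[ℝ] Π x : M, TangentSpace 𝓘(ℝ, E) x
  smooth : ∀ ξ : G, ContMDiffOn 𝓘(ℝ, E) 𝓘(ℝ, E).tangent ∞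
    (fun x => (⟨x, field ξ x⟩ : TangentBundle 𝓘(ℝ, E) M)) U
  map_lie : ∀ ξ η : G, ∀ x ∈ U, field ⁅ξ, η⁆ x = mlieBracket 𝓘(ℝ, E) (field ξ) (field η) x

variable {G}

/-- Smoothness on `U` of a section of the trivial bundle `G × M`, i.e. of a map into the
finite-dimensional vector space `G`: all its components are smooth. -/
def SmoothVecOn (X : M → G) (U : Set M) : Prop :=
  ∀ ℓ : Module.Dual ℝ G, ContMDiffOn 𝓘(ℝ, E) 𝓘(ℝ, ℝ) ∞ (fun x => ℓ (X x)) U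

variable {E}

/-- The canonical flat connection on the trivial bundle `G × M`: the derivative of a map into the
finite-dimensional vector space `G`, computed componentwise in a basis. -/
def flatDeriv [Module.Finite ℝ G] (X : M → G) (x : M) (u : TangentSpace 𝓘(ℝ, E) x) : G :=
  ∑ i, mvfderiv 𝓘(ℝ, E) (fun y => (Module.finBasis ℝ G).coord i (X y)) x u •
    Module.finBasis ℝ G i

/-- The anchor of the action algebroid `G × U`. -/
def LieAlgebraActionOn.anchor {U : Set M} (ρ : LieAlgebraActionOn E G U) (x : M) (ξ : G) :
    TangentSpace 𝓘(ℝ, E) x :=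
  ρ.field ξ x

/-- The bracket `[X, Y] = ∇_{#X} Y - ∇_{#Y} X + τ(X, Y)` of the action algebroid `G × U`, where
`∇` is the canonical flat connection and `τ` is the pointwise bracket. -/
def LieAlgebraActionOn.bracket [Module.Finite ℝ G] {U : Set M} (ρ : LieAlgebraActionOn E G U)
    (X Y : M → G) (x : M) : G :=
  flatDeriv Y x (ρ.anchor x (X x)) - flatDeriv X x (ρ.anchor x (Y x)) + ⁅X x, Y x⁆

end Action

namespace CartanAlgebroid

variable (A : CartanAlgebroid E F V)

/-- The operator `∇` on smooth sections. -/
def nabla (U : SmoothVectorField E M) (X : Cₛ^∞⟮𝓘(ℝ, E); F, V⟯) : Cₛ^∞⟮𝓘(ℝ, E); F, V⟯ :=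
  covSection A.conn A.smooth_conn U X

/-- The connection is flat: its curvature vanishes. -/
def IsFlat : Prop :=
  ∀ (U W : SmoothVectorField E M) (X : Cₛ^∞⟮𝓘(ℝ, E); F, V⟯),
    A.nabla U (A.nabla W X) - A.nabla W (A.nabla U X) - A.nabla (U.lie W) X = 0

/-- The fibrewise linear map `φ` is, over the open set `U`, an isomorphism of Cartan algebroids
from the action algebroid `G × U` with its canonical flat connection onto the restriction `A|_U`:
a bijective smooth morphism of vector bundles compatible with anchors, connections and brackets.
(A smooth bijective morphism of vector bundles has a smooth inverse.) -/
structure IsActionIsoOn {G : Type*} [LieRing G] [LieAlgebra ℝ G] [Module.Finite ℝ G] {U : Set M}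
    (ρ : LieAlgebraActionOn E G U) (φ : Π x : M, G →ₗ[ℝ] V x) : Prop where
  smooth : ∀ X : M → G, SmoothVecOn E X U → ContMDiffOn 𝓘(ℝ, E) (𝓘(ℝ, E).prod 𝓘(ℝ, F)) ∞
    (fun x => (⟨x, φ x (X x)⟩ : TotalSpace F V)) U
  bijective : ∀ x ∈ U, Function.Bijective (φ x)
  anchor_eq : ∀ x ∈ U, ∀ ξ : G, A.anchor x (φ x ξ) = ρ.anchor x ξ
  conn_eq : ∀ X : M → G, SmoothVecOn E X U → ∀ x ∈ U, ∀ u : TangentSpace 𝓘(ℝ, E) x,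
    A.conn (fun y => φ y (X y)) x u = φ x (flatDeriv X x u)
  bracket_eq : ∀ X Y : M → G, SmoothVecOn E X U → SmoothVecOn E Y U → ∀ x ∈ U,
    A.localBracket (fun y => φ y (X y)) (fun y => φ y (Y y)) x = φ x (ρ.bracket X Y x)

/-- The restriction of the Cartan algebroid to the open set `U` is symmetric: it is isomorphic to
the action algebroid `G × U`, with its canonical flat connection, of an action on `U` of some
finite-dimensional real Lie algebra `G`. -/
def IsSymmetricOn (U : Set M) : Prop :=
  ∃ (G : Type) (_ : LieRing G) (_ : LieAlgebra ℝ G) (_ : Module.Finite ℝ G)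
    (ρ : LieAlgebraActionOn E G U) (φ : Π x : M, G →ₗ[ℝ] V x), A.IsActionIsoOn ρ φ

/-- The Cartan algebroid is (globally) symmetric. -/
def IsSymmetric : Prop :=
  A.IsSymmetricOn Set.univ

/-- The Cartan algebroid is locally symmetric: every point has an open neighbourhood on which the
restriction is symmetric. -/
def IsLocallySymmetric : Prop :=
  ∀ x : M, ∃ U : Set M, IsOpen U ∧ x ∈ U ∧ A.IsSymmetricOn U

/-! ### The symmetric part -/

/-- The space of parallel sections. -/
def parallelSections : Submodule ℝ (Cₛ^∞⟮𝓘(ℝ, E); F, V⟯) where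
  carrier := {X | ∀ U : SmoothVectorField E M, A.nabla U X = 0}
  zero_mem' := by
    intro U
    ext x
    simp [nabla, covSection]
  add_mem' := by
    intro X Y hX hY U
    ext x
    have h1 := DFunLike.congr_fun (hX U) x
    have h2 := DFunLike.congr_fun (hY U) x
    simp only [nabla, covSection, ContMDiffSection.coeFn_mk] at h1 h2
    simp only [nabla, covSection, ContMDiffSection.coeFn_mk, ContMDiffSection.coe_add]
    rw [A.conn.isCovariantDerivativeOnUniv.add X.mdifferentiableAt Y.mdifferentiableAt]
    simp [h1, h2]
  smul_mem' := by
    intro c X hX U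
    ext x
    have h1 := DFunLike.congr_fun (hX U) x
    simp only [nabla, covSection, ContMDiffSection.coeFn_mk] at h1
    simp only [nabla, covSection, ContMDiffSection.coeFn_mk, ContMDiffSection.coe_smul]
    rw [A.conn.isCovariantDerivativeOnUniv.smul_const c X.mdifferentiableAt]
    simp [h1]

/-- The bracket of parallel sections is parallel. -/
theorem bracket_mem_parallelSections {X Y : Cₛ^∞⟮𝓘(ℝ, E); F, V⟯}
    (hX : X ∈ A.parallelSections) (hY : Y ∈ A.parallelSections) :
    A.bracket X Y ∈ A.parallelSections := by
  intro U
  have hX' : ∀ U, covSection A.conn A.smooth_conn U X = 0 := hX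
  have hY' : ∀ U, covSection A.conn A.smooth_conn U Y = 0 := hY
  have h := A.compat X Y U
  simp only [hX', hY', map_zero, LinearMap.zero_apply, add_zero, sub_zero] at h
  exact h

/-- The parallel sections form a Lie algebra under the bracket of the algebroid. -/
instance : LieRing A.parallelSections where
  bracket X Y := ⟨A.bracket X Y, A.bracket_mem_parallelSections X.2 Y.2⟩
  add_lie X Y Z := Subtype.ext (by simp)
  lie_add X Y Z := Subtype.ext (by simp)
  lie_self X := Subtype.ext (A.bracket_self X)
  leibniz_lie X Y Z := Subtype.ext (A.jacobi X Y Z)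

instance : LieAlgebra ℝ A.parallelSections where
  lie_smul c X Y := Subtype.ext (by simp [Bracket.bracket])

/-- The action on `M` of the Lie algebra of parallel sections, `(X, m) ↦ #X(m)`. -/
def parallelAction : LieAlgebraActionOn E A.parallelSections (Set.univ : Set M) where
  field :=
    { toFun := fun X x => A.anchor x (X.1 x)
      map_add' := fun X Y => by ext x; simp
      map_smul' := fun c X => by ext x; simp }
  smooth X := (A.anchorField X.1).contMDiff.contMDiffOn
  map_lie X Y x _ := A.anchor_bracket X.1 Y.1 x

/-- The morphism `(X, m) ↦ X(m)` from the trivial bundle of parallel sections. -/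
def parallelEval (x : M) : A.parallelSections →ₗ[ℝ] V x where
  toFun X := X.1 x
  map_add' _ _ := rfl
  map_smul' _ _ := rfl

end CartanAlgebroid

end Algebroids

end

/-! Everything reduces to local parallel frames: smooth families of linear isomorphisms from a fixed
vector space onto the fibres, each constant vector giving a parallel section. Constant sections of
an action algebroid are parallel, so local symmetry supplies such frames. In a parallel frame `∇`
differentiates components, and the curvature becomes the identity between the Lie bracket and the
commutator of derivations on functions. Hence `∇` is flat (`isFlat_of_isParallelFrameOn`).
Conversely, in a chart and a trivialization `∇ = d + Γ`, and flatness says `dΓ + Γ ∧ Γ = 0`. Then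
`dP = -ΓP` has a local invertible solution, obtained by parallel transport along rays; the structure
equation makes the radial solution parallel in every direction (`radial_transport_estimate`,
`exists_flat_gauge`). The columns of `P` form a parallel frame. The Cartan condition turns such a
frame into an action: each correction term in the formula for `∇[X, Y]` contains `∇X` or `∇Y`, so
brackets of parallel sections are parallel. Over a connected open set they have constant components,
which define a Lie algebra acting through the anchor. The Leibniz rule then determines the bracket
of all sections, and it is the action algebroid bracket (`isActionIsoOn_of_parallel`). Globally,
germs of parallel sections form a covering of `M`. If `M` is simply connected, each germ extends to
a global parallel section (`exists_locallyConstant_section`). Such a section is determined by its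
value at one point, so evaluation is an isomorphism on every fibre and the space of parallel
sections is finite-dimensional. -/

set_option linter.unusedSectionVars false

/-! ## Local integration of flat connection forms -/

section FlatForms

variable {E : Type*} [NormedAddCommGroup E] [NormedSpace ℝ E]
  {R : Type*} [NormedRing R] [NormedAlgebra ℝ R]

/-- Existence of the radial parallel transport of a small connection form. -/
theorem exists_radial_transport [CompleteSpace R] {A : E → E →L[ℝ] R} {r C : ℝ} (hC : 0 ≤ C)
    (hA : ContinuousOn A (Metric.ball 0 r)) (hAC : ∀ z ∈ Metric.ball (0 : E) r, ‖A z‖ ≤ C)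
    (hrC : C * r ≤ 1 / 2) {x : E} (hx : x ∈ Metric.ball (0 : E) r) :
    ∃ Q : ℝ → R, Q 0 = 1 ∧ ∀ t ∈ Set.Icc (0 : ℝ) 1,
      HasDerivWithinAt Q (-(A (t • x) x * Q t)) (Set.Icc 0 1) t := by
  have hxr : ‖x‖ ≤ r := (mem_ball_zero_iff.1 hx).le
  have hmem : ∀ t ∈ Set.Icc (0 : ℝ) 1, t • x ∈ Metric.ball (0 : E) r := by
    intro t ht
    rw [mem_ball_zero_iff] at hx ⊢
    rw [norm_smul, Real.norm_of_nonneg ht.1]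
    exact (mul_le_of_le_one_left (norm_nonneg _) ht.2).trans_lt hx
  have hb : ∀ t ∈ Set.Icc (0 : ℝ) 1, ‖A (t • x) x‖ ≤ 1 / 2 := fun t ht =>
    ((A (t • x)).le_opNorm x).trans <|
      (mul_le_mul (hAC _ (hmem t ht)) hxr (norm_nonneg _) hC).trans hrC
  -- On the ball of radius `‖1‖` about `1` one has `‖q‖ ≤ 2‖1‖`. As `‖A (t • x) x‖ ≤ 1/2`, the speed
  -- is at most `‖1‖`, so the solution stays in this ball for unit time.
  have hPL : IsPicardLindelof (fun t q => -(A (t • x) x * q)) (tmin := 0) (tmax := 1)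
      ⟨0, by simp⟩ (1 : R) ‖(1 : R)‖₊ 0 ‖(1 : R)‖₊ 1 := by
    refine ⟨fun t ht => LipschitzOnWith.of_dist_le_mul fun q _ q' _ => ?_, fun q _ => ?_,
      fun t ht q hq => ?_, by simp⟩
    · rw [dist_neg_neg, dist_eq_norm, ← mul_sub, dist_eq_norm]
      refine (norm_mul_le _ _).trans ?_
      have := hb t ht
      simp only [NNReal.coe_one]
      gcongr
      linarith
    · refine ((ContinuousOn.clm_apply ?_ continuousOn_const).mul continuousOn_const).neg
      exact hA.comp (by fun_prop) hmem
    · rw [norm_neg]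
      refine (norm_mul_le _ _).trans ?_
      have h1 : ‖q‖ ≤ 2 * ‖(1 : R)‖ := by
        have h2 : ‖q - 1‖ ≤ ‖(1 : R)‖ := by simpa [dist_eq_norm] using hq
        have := norm_le_norm_add_norm_sub' q 1
        linarith
      calc ‖A (t • x) x‖ * ‖q‖ ≤ 1 / 2 * (2 * ‖(1 : R)‖) :=
            mul_le_mul (hb t ht) h1 (norm_nonneg _) (by norm_num)
        _ = ‖(1 : R)‖₊ := by simp
  obtain ⟨Q, hQ, hQ'⟩ := hPL.exists_eq_forall_mem_Icc_hasDerivWithinAt₀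
  exact ⟨Q, hQ, hQ'⟩

/-- The radial transport of a flat connection form is parallel in all directions. -/
theorem radial_transport_estimate {A : E → E →L[ℝ] R} {A' : E → E →L[ℝ] E →L[ℝ] R} {r C K : ℝ}
    (hC : 0 < C) (hK : 0 ≤ K) (hr : r ≤ 1)
    (hA : ∀ z ∈ Metric.ball (0 : E) r, HasFDerivAt A (A' z) z)
    (hAC : ∀ z ∈ Metric.ball (0 : E) r, ‖A z‖ ≤ C)
    (hA1 : ∀ z ∈ Metric.ball (0 : E) r, ∀ w ∈ Metric.ball (0 : E) r, ‖A w - A z‖ ≤ K * ‖w - z‖)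
    (hA2 : ∀ z ∈ Metric.ball (0 : E) r, ∀ w ∈ Metric.ball (0 : E) r,
      ‖A w - A z - A' z (w - z)‖ ≤ K * ‖w - z‖ ^ 2)
    (hflat : ∀ z ∈ Metric.ball (0 : E) r, ∀ v w,
      A' z v w - A' z w v + (A z v * A z w - A z w * A z v) = 0)
    {x h : E} (hx : x ∈ Metric.ball (0 : E) r) (hxh : x + h ∈ Metric.ball (0 : E) r)
    {Q Qh : ℝ → R} (hQ0 : Q 0 = 1) (hQh0 : Qh 0 = 1)
    (hQ : ∀ t ∈ Set.Icc (0 : ℝ) 1,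
      HasDerivWithinAt Q (-(A (t • x) x * Q t)) (Set.Icc 0 1) t)
    (hQh : ∀ t ∈ Set.Icc (0 : ℝ) 1,
      HasDerivWithinAt Qh (-(A (t • (x + h)) (x + h) * Qh t)) (Set.Icc 0 1) t)
    {B : ℝ} (hB : ∀ t ∈ Set.Icc (0 : ℝ) 1, ‖Q t‖ ≤ B) :
    ‖Qh 1 - Q 1 + A x h * Q 1‖ ≤ (2 * K + (K + C) * C) * B / C * (Real.exp C - 1) * ‖h‖ ^ 2 := by
  have hmem : ∀ y ∈ Metric.ball (0 : E) r, ∀ t ∈ Set.Icc (0 : ℝ) 1,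
      t • y ∈ Metric.ball (0 : E) r := by
    intro y hy t ht
    rw [mem_ball_zero_iff] at hy ⊢
    rw [norm_smul, Real.norm_of_nonneg ht.1]
    exact (mul_le_of_le_one_left (norm_nonneg _) ht.2).trans_lt hy
  have hx1 : ‖x‖ ≤ 1 := (mem_ball_zero_iff.1 hx).le.trans hr
  have hxh1 : ‖x + h‖ ≤ 1 := (mem_ball_zero_iff.1 hxh).le.trans hr
  have hB0 : 0 ≤ B := (norm_nonneg _).trans (hB 0 (by simp))
  -- `D` is the error in the expected first-order change `-A (t • x) (t • h) * Q t` of the transport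
  -- at time `t`. It vanishes at `0`, and its value at `1` is the quantity to be bounded. It solves
  -- the transport equation along the ray of `x + h` up to the source `e`, which is quadratic in
  -- `h`.
  set D : ℝ → R := fun t => Qh t - Q t + t • (A (t • x) h * Q t) with hD
  set e : ℝ → R := fun t => (A (t • x) x + A (t • x) h - A (t • (x + h)) (x + h)
    + t • A' (t • x) h x + t • ((A (t • (x + h)) (x + h) - A (t • x) x) * A (t • x) h)) * Q t
    with he
  have hderiv : ∀ t ∈ Set.Icc (0 : ℝ) 1,
      HasDerivWithinAt D (-(A (t • (x + h)) (x + h) * D t) + e t) (Set.Icc 0 1) t := by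
    intro t ht
    have h1 : HasDerivWithinAt (fun t : ℝ => A (t • x) h) (A' (t • x) x h) (Set.Icc 0 1) t := by
      have h2 : HasDerivAt (fun t : ℝ => t • x) x t := by
        simpa using (hasDerivAt_id t).smul_const x
      have h3 := (hA _ (hmem x hx t ht)).comp_hasDerivAt t h2
      exact (h3.clm_apply (hasDerivAt_const t h)).hasDerivWithinAt.congr_deriv (by simp)
    have h4 := ((hQh t ht).sub (hQ t ht)).add
      ((hasDerivWithinAt_id t _).smul (h1.mul (hQ t ht)))
    refine h4.congr_deriv ?_
    -- Flatness exchanges the radial derivative of `A` in direction `h` for the derivative along `h`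
    -- of its radial part. The commutator is what allows the first-order terms of `e` to cancel.
    have h5 : A' (t • x) x h = A' (t • x) h x
        - (A (t • x) x * A (t • x) h - A (t • x) h * A (t • x) x) := by
      have := hflat _ (hmem x hx t ht) x h
      rw [add_eq_zero_iff_eq_neg, sub_eq_iff_eq_add] at this
      rw [this]; abel
    simp only [hD, he, h5, id]
    simp only [mul_add, mul_sub, add_mul, sub_mul, mul_neg, smul_add, smul_sub, smul_neg,
      mul_smul_comm, smul_mul_assoc, one_smul, mul_assoc]
    abel
  have hebd : ∀ t ∈ Set.Icc (0 : ℝ) 1, ‖e t‖ ≤ (2 * K + (K + C) * C) * B * ‖h‖ ^ 2 := by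
    intro t ht
    have hz := hmem x hx t ht
    have hw := hmem _ hxh t ht
    have hwz : t • (x + h) - t • x = t • h := by rw [smul_add]; abel
    have hth : ‖t • h‖ ≤ ‖h‖ := by
      rw [norm_smul, Real.norm_of_nonneg ht.1]
      exact mul_le_of_le_one_left (norm_nonneg _) ht.2
    have b1 : ‖A (t • (x + h)) - A (t • x)‖ ≤ K * ‖h‖ := by
      refine (hA1 _ hz _ hw).trans ?_
      rw [hwz]; gcongr
    have b2 : ‖A (t • (x + h)) - A (t • x) - A' (t • x) (t • h)‖ ≤ K * ‖h‖ ^ 2 := by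
      have := hA2 _ hz _ hw
      rw [hwz] at this
      refine this.trans ?_
      gcongr
    -- A second-order Taylor remainder applied to `x`, plus a first-order increment applied to `h`.
    have e1 : A (t • x) x + A (t • x) h - A (t • (x + h)) (x + h) + t • A' (t • x) h x
        = -((A (t • (x + h)) - A (t • x) - A' (t • x) (t • h)) x
          + (A (t • (x + h)) - A (t • x)) h) := by
      simp only [map_add, map_smul, sub_apply, smul_apply]
      abel
    have e2 : A (t • (x + h)) (x + h) - A (t • x) x
        = (A (t • (x + h)) - A (t • x)) (x + h) + A (t • x) h := by
      simp only [map_add, sub_apply]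
      abel
    have n1 : ‖A (t • x) x + A (t • x) h - A (t • (x + h)) (x + h) + t • A' (t • x) h x‖
        ≤ 2 * K * ‖h‖ ^ 2 := by
      rw [e1, norm_neg]
      refine (norm_add_le _ _).trans ?_
      have i1 := ContinuousLinearMap.le_of_opNorm_le_of_le _ b2 hx1
      have i2 := ContinuousLinearMap.le_of_opNorm_le _ b1 h
      nlinarith
    have n2 : ‖A (t • (x + h)) (x + h) - A (t • x) x‖ ≤ (K + C) * ‖h‖ := by
      rw [e2]
      refine (norm_add_le _ _).trans ?_
      have i1 := ContinuousLinearMap.le_of_opNorm_le_of_le _ b1 hxh1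
      have i2 := ContinuousLinearMap.le_of_opNorm_le _ (hAC _ hz) h
      linarith
    have n3 : ‖A (t • x) h‖ ≤ C * ‖h‖ := ContinuousLinearMap.le_of_opNorm_le _ (hAC _ hz) h
    have n4 : ‖t • ((A (t • (x + h)) (x + h) - A (t • x) x) * A (t • x) h)‖
        ≤ (K + C) * ‖h‖ * (C * ‖h‖) := by
      rw [norm_smul, Real.norm_of_nonneg ht.1]
      refine (mul_le_of_le_one_left (norm_nonneg _) ht.2).trans ((norm_mul_le _ _).trans ?_)
      exact mul_le_mul n2 n3 (norm_nonneg _) (by positivity)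
    calc ‖e t‖ ≤ (2 * K * ‖h‖ ^ 2 + (K + C) * ‖h‖ * (C * ‖h‖)) * B :=
          (norm_mul_le _ _).trans <| mul_le_mul ((norm_add_le _ _).trans (add_le_add n1 n4))
            (hB t ht) (norm_nonneg _) (by positivity)
      _ = _ := by ring
  -- Grönwall with zero initial error and a source of size `‖h‖ ^ 2`; no differentiability of the
  -- flow in its parameters is needed.
  have hG := norm_le_gronwallBound_of_norm_deriv_right_le (f := D) (δ := 0) (K := C)
    (ε := (2 * K + (K + C) * C) * B * ‖h‖ ^ 2) (a := 0) (b := 1)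
    (fun t ht => (hderiv t ht).continuousWithinAt)
    (fun t ht => ((hderiv t ⟨ht.1, ht.2.le⟩).mono_of_mem_nhdsWithin
      (Icc_mem_nhdsGE_of_mem ht)))
    (by simp [hD, hQ0, hQh0])
    (fun t ht => by
      have ht' : t ∈ Set.Icc (0 : ℝ) 1 := ⟨ht.1, ht.2.le⟩
      refine (norm_add_le _ _).trans (add_le_add ?_ (hebd t ht'))
      rw [norm_neg]
      refine (norm_mul_le _ _).trans ?_
      gcongr
      simpa using ContinuousLinearMap.le_of_opNorm_le_of_le _ (hAC _ (hmem _ hxh t ht')) hxh1)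
    1 (by simp)
  rw [gronwallBound_of_K_ne_0 hC.ne'] at hG
  simp only [hD, one_smul, zero_mul, zero_add, sub_zero, mul_one] at hG
  refine hG.trans_eq ?_
  ring

/-- The value `P x` is the radial transport of `1` from `0` to `x`, taken at time `1`. The quadratic
estimate identifies its full derivative, and invertibility near `0` follows from `P 0 = 1` because
units form an open set. -/
theorem exists_flat_gauge_zero [CompleteSpace R] {A : E → E →L[ℝ] R} {Ω : Set E}
    (hΩ : Ω ∈ 𝓝 (0 : E)) (hA : ContDiffOn ℝ ∞ A Ω)
    (hflat : ∀ z ∈ Ω, ∀ v w,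
      fderiv ℝ A z v w - fderiv ℝ A z w v + (A z v * A z w - A z w * A z v) = 0) :
    ∃ P : E → R, ∃ r > 0, Metric.ball 0 r ⊆ Ω ∧ P 0 = 1 ∧ ContDiffOn ℝ ∞ P (Metric.ball 0 r) ∧
      ∀ z ∈ Metric.ball (0 : E) r, IsUnit (P z) ∧ ∀ v, fderiv ℝ P z v = -(A z v * P z) := by
  have hAat : ContDiffAt ℝ ∞ A 0 := hA.contDiffAt hΩ
  obtain ⟨K₁, s₁, hs₁, hL₁⟩ := (hAat.of_le (m := 1) (by exact_mod_cast le_top)).exists_lipschitzOnWith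
  obtain ⟨K₂, s₂, hs₂, hL₂⟩ :=
    (hAat.fderiv_right (m := 1) (by decide)).exists_lipschitzOnWith
  have hs₃ : ∀ᶠ z in 𝓝 (0 : E), ‖A z‖ < ‖A 0‖ + 1 :=
    hAat.continuousAt.norm.eventually_lt_const (by linarith)
  obtain ⟨r₀, hr₀, hball⟩ := Metric.mem_nhds_iff.1
    (Filter.inter_mem (Filter.inter_mem (interior_mem_nhds.2 hΩ) hs₃) (Filter.inter_mem hs₁ hs₂))
  set C : ℝ := ‖A 0‖ + 1 with hCdef
  have hC : 0 < C := by positivity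
  set K : ℝ := max K₁ K₂ with hKdef
  have hK : 0 ≤ K := K₁.2.trans (le_max_left _ _)
  -- The three bounds keep the ball inside the region of the Lipschitz estimates, give `‖x‖ ≤ 1` in
  -- the error estimate, and give `C * r ≤ 1 / 2` for Picard–Lindelöf.
  set r : ℝ := min r₀ (min 1 (1 / (2 * C))) with hrdef
  have hr : 0 < r := by positivity
  have hrr₀ : Metric.ball (0 : E) r ⊆ Metric.ball 0 r₀ := Metric.ball_subset_ball (min_le_left _ _)
  have hr1 : r ≤ 1 := (min_le_right _ _).trans (min_le_left _ _)
  have hCr : C * r ≤ 1 / 2 := by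
    have : r ≤ 1 / (2 * C) := (min_le_right _ _).trans (min_le_right _ _)
    calc C * r ≤ C * (1 / (2 * C)) := by gcongr
      _ = 1 / 2 := by field_simp
  have hΩr : Metric.ball (0 : E) r ⊆ Ω := fun z hz => interior_subset (hball (hrr₀ hz)).1.1
  have hAd : ∀ z ∈ Metric.ball (0 : E) r, HasFDerivAt A (fderiv ℝ A z) z := fun z hz =>
    ((hA.contDiffAt (mem_interior_iff_mem_nhds.1 (hball (hrr₀ hz)).1.1)).differentiableAt
      (by simp)).hasFDerivAt
  have hAC : ∀ z ∈ Metric.ball (0 : E) r, ‖A z‖ ≤ C := fun z hz => le_of_lt (hball (hrr₀ hz)).1.2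
  have hA1 : ∀ z ∈ Metric.ball (0 : E) r, ∀ w ∈ Metric.ball (0 : E) r,
      ‖A w - A z‖ ≤ K * ‖w - z‖ := by
    intro z hz w hw
    refine (hL₁.norm_sub_le (hball (hrr₀ hw)).2.1 (hball (hrr₀ hz)).2.1).trans ?_
    gcongr
    exact le_max_left _ _
  have hA2 : ∀ z ∈ Metric.ball (0 : E) r, ∀ w ∈ Metric.ball (0 : E) r,
      ‖A w - A z - fderiv ℝ A z (w - z)‖ ≤ K * ‖w - z‖ ^ 2 := by
    intro z hz w hw
    have hseg : segment ℝ z w ⊆ Metric.ball (0 : E) r := (convex_ball _ _).segment_subset hz hw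
    have := Convex.norm_image_sub_le_of_norm_hasFDerivWithin_le' (f := A) (f' := fderiv ℝ A)
      (φ := fderiv ℝ A z) (C := K * ‖w - z‖)
      (fun y hy => (hAd y (hseg hy)).hasFDerivWithinAt) (fun y hy => by
        refine (hL₂.norm_sub_le (hball (hrr₀ (hseg hy))).2.2 (hball (hrr₀ hz)).2.2).trans ?_
        gcongr
        · exact le_max_right _ _
        · obtain ⟨a, b, ha, hb, hab, rfl⟩ := hy
          have : a • z + b • w - z = b • (w - z) := by
            rw [← eq_sub_iff_add_eq] at hab
            rw [hab]; module
          rw [this, norm_smul, Real.norm_of_nonneg hb]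
          exact mul_le_of_le_one_left (norm_nonneg _) (by linarith))
      (convex_segment z w) (left_mem_segment ℝ z w) (right_mem_segment ℝ z w)
    exact this.trans_eq (by ring)
  -- Outside the ball the constant `1` is a dummy value, which makes the choice of `Q` total.
  have hex : ∀ x : E, ∃ Q : ℝ → R, Q 0 = 1 ∧ (x ∈ Metric.ball (0 : E) r →
      ∀ t ∈ Set.Icc (0 : ℝ) 1, HasDerivWithinAt Q (-(A (t • x) x * Q t)) (Set.Icc 0 1) t) := by
    intro x
    by_cases hx : x ∈ Metric.ball (0 : E) r
    · obtain ⟨Q, h1, h2⟩ := exists_radial_transport hC.le (hA.continuousOn.mono hΩr) hAC hCr hx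
      exact ⟨Q, h1, fun _ => h2⟩
    · exact ⟨fun _ => 1, rfl, fun h => absurd h hx⟩
  choose Q hQ0 hQ using hex
  set P : E → R := fun x => Q x 1 with hP
  have hP0 : P 0 = 1 := by
    rw [← hQ0 0]
    have h0 : (0 : E) ∈ Metric.ball (0 : E) r := Metric.mem_ball_self hr
    refine constant_of_has_deriv_right_zero (f := Q 0) (a := 0) (b := 1)
      (fun t ht => (hQ 0 h0 t ht).continuousWithinAt) (fun t ht => ?_) 1 (by simp)
    have := (hQ 0 h0 t ⟨ht.1, ht.2.le⟩).mono_of_mem_nhdsWithin (Icc_mem_nhdsGE_of_mem ht)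
    simpa using this
  have hPd : ∀ x ∈ Metric.ball (0 : E) r,
      HasFDerivAt P (-((ContinuousLinearMap.mul ℝ R).flip (P x) ∘L A x)) x := by
    intro x hx
    have hQc : ContinuousOn (Q x) (Set.Icc 0 1) := fun t ht => (hQ x hx t ht).continuousWithinAt
    obtain ⟨B, hB⟩ := isCompact_Icc.exists_bound_of_continuousOn hQc
    rw [hasFDerivAt_iff_isLittleO_nhds_zero]
    have hO : (fun h => P (x + h) - P x - (-((ContinuousLinearMap.mul ℝ R).flip (P x) ∘L A x)) h)
        =O[𝓝 0] fun h : E => ‖h‖ ^ 2 := by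
      refine Asymptotics.IsBigO.of_bound ((2 * K + (K + C) * C) * B / C * (Real.exp C - 1)) ?_
      have : ∀ᶠ h in 𝓝 (0 : E), x + h ∈ Metric.ball (0 : E) r :=
        (continuous_const.add continuous_id).continuousAt.eventually_mem
          (Metric.isOpen_ball.mem_nhds (by simpa using hx))
      filter_upwards [this] with h hh
      have := radial_transport_estimate hC hK hr1 hAd hAC hA1 hA2
        (fun z hz => hflat z (hΩr hz)) hx hh (hQ0 x) (hQ0 _) (hQ x hx) (hQ _ hh) hB
      simpa using this
    refine hO.trans_isLittleO ?_
    have := Asymptotics.isLittleO_norm_pow_id (E' := E) (n := 2) (by norm_num)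
    exact this
  -- Bootstrap: the equation expresses the derivative of `P` through `A` and `P`, so each order of
  -- regularity of `P` yields the next.
  have hPsmooth : ContDiffOn ℝ ∞ P (Metric.ball 0 r) := by
    rw [contDiffOn_infty]
    intro n
    induction n with
    | zero => exact contDiffOn_zero.2 fun x hx => (hPd x hx).continuousAt.continuousWithinAt
    | succ n ih =>
      rw [Nat.cast_add, Nat.cast_one, contDiffOn_succ_iff_fderiv_of_isOpen Metric.isOpen_ball]
      refine ⟨fun x hx => (hPd x hx).differentiableAt.differentiableWithinAt, by simp, ?_⟩
      have h1 : ContDiffOn ℝ n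
          (fun x => -((ContinuousLinearMap.mul ℝ R).flip (P x) ∘L A x)) (Metric.ball 0 r) :=
        (((ContinuousLinearMap.mul ℝ R).flip.contDiff.comp_contDiffOn ih).clm_comp
          ((hA.mono hΩr).of_le (by exact_mod_cast le_top))).neg
      exact h1.congr fun x hx => (hPd x hx).fderiv
  have hunit : ∀ᶠ z in 𝓝 (0 : E), IsUnit (P z) := by
    have h1 : ContinuousAt P 0 := (hPd 0 (Metric.mem_ball_self hr)).continuousAt
    refine h1.eventually_mem (Units.isOpen.mem_nhds ?_)
    rw [hP0]
    exact isUnit_one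
  obtain ⟨r₁, hr₁, hball₁⟩ := Metric.mem_nhds_iff.1 hunit
  have hsub : Metric.ball (0 : E) (min r r₁) ⊆ Metric.ball 0 r :=
    Metric.ball_subset_ball (min_le_left _ _)
  refine ⟨P, min r r₁, lt_min hr hr₁, hsub.trans hΩr, hP0, hPsmooth.mono hsub, fun z hz =>
    ⟨hball₁ (Metric.ball_subset_ball (min_le_right _ _) hz), fun v => ?_⟩⟩
  rw [(hPd z (hsub hz)).fderiv]
  simp

/-- A flat connection form, with values in a Banach algebra, is locally gauge equivalent to
zero: the equation `dP = -A P` has a local invertible solution. -/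
theorem exists_flat_gauge [CompleteSpace R] {A : E → E →L[ℝ] R} {Ω : Set E} {z₀ : E}
    (hΩ : Ω ∈ 𝓝 z₀) (hA : ContDiffOn ℝ ∞ A Ω)
    (hflat : ∀ z ∈ Ω, ∀ v w,
      fderiv ℝ A z v w - fderiv ℝ A z w v + (A z v * A z w - A z w * A z v) = 0) :
    ∃ P : E → R, ∃ r > 0, Metric.ball z₀ r ⊆ Ω ∧ ContDiffOn ℝ ∞ P (Metric.ball z₀ r) ∧
      ∀ z ∈ Metric.ball z₀ r, IsUnit (P z) ∧ ∀ v, fderiv ℝ P z v = -(A z v * P z) := by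
  have hcont : ContinuousAt (fun z : E => z₀ + z) 0 := by fun_prop
  obtain ⟨P, r, hr, hsub, -, hP, hP'⟩ := exists_flat_gauge_zero (A := fun z => A (z₀ + z))
    (Ω := (fun z => z₀ + z) ⁻¹' Ω) (hcont.preimage_mem_nhds (by simpa using hΩ))
    (hA.comp (by fun_prop) fun z hz => hz) (fun z hz v w => by
      rw [fderiv_comp_add_left]
      exact hflat _ hz v w)
  have hball : ∀ z, z ∈ Metric.ball z₀ r → -z₀ + z ∈ Metric.ball (0 : E) r := by
    intro z hz
    rw [mem_ball_iff_norm] at hz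
    rwa [mem_ball_zero_iff, neg_add_eq_sub]
  refine ⟨fun z => P (-z₀ + z), r, hr, fun z hz => ?_, hP.comp (by fun_prop) hball,
    fun z hz => ⟨(hP' _ (hball z hz)).1, fun v => ?_⟩⟩
  · simpa using hsub (hball z hz)
  · rw [fderiv_comp_add_left, (hP' _ (hball z hz)).2]
    simp

end FlatForms

/-! ## Frames of vector bundles and connections -/

section Frames

variable {E : Type*} [NormedAddCommGroup E] [NormedSpace ℝ E]
  {M : Type*} [TopologicalSpace M] [ChartedSpace E M]
  {F : Type*} [NormedAddCommGroup F] [NormedSpace ℝ F]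
  {V : M → Type*} [TopologicalSpace (TotalSpace F V)] [∀ x, TopologicalSpace (V x)]
  [FiberBundle F V] [∀ x, AddCommGroup (V x)] [∀ x, Module ℝ (V x)]
  {H : Type*} [NormedAddCommGroup H] [NormedSpace ℝ H] [FiniteDimensional ℝ H]

theorem mvfderiv_clm_comp {H' : Type*} [NormedAddCommGroup H'] [NormedSpace ℝ H'] (ℓ : H →L[ℝ] H')
    {g : M → H} {x : M} (hg : MDifferentiableAt 𝓘(ℝ, E) 𝓘(ℝ, H) g x)
    (u : TangentSpace 𝓘(ℝ, E) x) :
    mvfderiv 𝓘(ℝ, E) (fun y => ℓ (g y)) x u = ℓ (mvfderiv 𝓘(ℝ, E) g x u) := by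
  have := ((ℓ.hasMFDerivAt (x := g x)).comp x hg.hasMFDerivAt).mfderiv
  exact DFunLike.congr_fun this u

/-- Reduces statements about `φ y (g y)`, for a family `φ` of linear maps, to finitely many scalar
functions times the sections given by basis vectors. -/
theorem linearMap_apply_eq_sum {G W : Type*} [AddCommGroup G] [Module ℝ G] [Module.Finite ℝ G]
    [AddCommGroup W] [Module ℝ W] (φ : G →ₗ[ℝ] W) (ξ : G) :
    φ ξ = ∑ i, (Module.finBasis ℝ G).coord i ξ • φ (Module.finBasis ℝ G i) := by
  conv_lhs => rw [← (Module.finBasis ℝ G).sum_repr ξ, map_sum]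
  simp only [map_smul, Module.Basis.coord_apply]

section

variable [VectorBundle ℝ F V]

theorem ContMDiffAt.frame_apply {n : ℕ∞ω} {φ : Π x : M, H →ₗ[ℝ] V x} {x : M} {g : M → H}
    (hφ : ∀ ξ, ContMDiffAt 𝓘(ℝ, E) (𝓘(ℝ, E).prod 𝓘(ℝ, F)) n
      (fun y => (⟨y, φ y ξ⟩ : TotalSpace F V)) x)
    (hg : ContMDiffAt 𝓘(ℝ, E) 𝓘(ℝ, H) n g x) :
    ContMDiffAt 𝓘(ℝ, E) (𝓘(ℝ, E).prod 𝓘(ℝ, F)) n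
      (fun y => (⟨y, φ y (g y)⟩ : TotalSpace F V)) x := by
  simp_rw [fun y => linearMap_apply_eq_sum (φ y) (g y)]
  refine ContMDiffAt.sum_section fun i _ => ContMDiffAt.smul_section ?_ (hφ _)
  exact (LinearMap.toContinuousLinearMap ((Module.finBasis ℝ H).coord i)).contMDiff.contMDiffAt.comp
    x hg

theorem MDifferentiableAt.frame_apply {φ : Π x : M, H →ₗ[ℝ] V x} {x : M} {g : M → H}
    (hφ : ∀ ξ, MDifferentiableAt 𝓘(ℝ, E) (𝓘(ℝ, E).prod 𝓘(ℝ, F))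
      (fun y => (⟨y, φ y ξ⟩ : TotalSpace F V)) x)
    (hg : MDifferentiableAt 𝓘(ℝ, E) 𝓘(ℝ, H) g x) :
    MDifferentiableAt 𝓘(ℝ, E) (𝓘(ℝ, E).prod 𝓘(ℝ, F))
      (fun y => (⟨y, φ y (g y)⟩ : TotalSpace F V)) x := by
  simp_rw [fun y => linearMap_apply_eq_sum (φ y) (g y)]
  refine MDifferentiableAt.sum_section fun i _ => MDifferentiableAt.smul_section ?_ (hφ _)
  exact (LinearMap.toContinuousLinearMap
    ((Module.finBasis ℝ H).coord i)).mdifferentiableAt.comp x hg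

section Conn

variable [∀ x, IsTopologicalAddGroup (V x)] [∀ x, ContinuousSMul ℝ (V x)]
  (conn : CovariantDerivative 𝓘(ℝ, E) F V)

/-- Locality of `∇` lets local frames and their global smooth extensions be used interchangeably. -/
theorem CovariantDerivative.congr_germ {σ τ : Π x : M, V x} {x : M}
    (hσ : MDifferentiableAt 𝓘(ℝ, E) (𝓘(ℝ, E).prod 𝓘(ℝ, F))
      (fun y => (⟨y, σ y⟩ : TotalSpace F V)) x)
    (h : ∀ᶠ y in 𝓝 x, σ y = τ y) : conn σ x = conn τ x := by
  refine conn.isCovariantDerivativeOnUniv.congr_of_eventuallyEq hσ ?_ Filter.univ_mem h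
  refine hσ.congr_of_eventuallyEq ?_
  filter_upwards [h] with y hy
  rw [hy]

theorem CovariantDerivative.sum_smul {ι : Type*} (t : Finset ι) (f : ι → M → ℝ)
    (s : ι → Π x : M, V x) {x : M}
    (hf : ∀ i, MDifferentiableAt 𝓘(ℝ, E) 𝓘(ℝ, ℝ) (f i) x)
    (hs : ∀ i, MDifferentiableAt 𝓘(ℝ, E) (𝓘(ℝ, E).prod 𝓘(ℝ, F))
      (fun y => (⟨y, s i y⟩ : TotalSpace F V)) x) (u : TangentSpace 𝓘(ℝ, E) x) :
    conn (fun y => ∑ i ∈ t, f i y • s i y) x u =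
      ∑ i ∈ t, (mvfderiv 𝓘(ℝ, E) (f i) x u • s i x + f i x • conn (s i) x u) := by
  classical
  induction t using Finset.induction_on with
  | empty =>
    simp only [Finset.sum_empty]
    change conn (0 : Π x : M, V x) x u = 0
    simp
  | insert i t hi ih =>
    have h1 : (fun y => ∑ j ∈ insert i t, f j y • s j y) =
        (f i • s i) + fun y => ∑ j ∈ t, f j y • s j y := by
      ext y
      simp [Finset.sum_insert hi]
    have h2 : MDifferentiableAt 𝓘(ℝ, E) (𝓘(ℝ, E).prod 𝓘(ℝ, F))
        (fun y => (⟨y, ∑ j ∈ t, f j y • s j y⟩ : TotalSpace F V)) x :=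
      MDifferentiableAt.sum_section fun j _ => (hf j).smul_section (hs j)
    rw [h1, conn.isCovariantDerivativeOnUniv.add ((hf i).smul_section (hs i)) h2,
      conn.isCovariantDerivativeOnUniv.leibniz (hs i) (hf i), Finset.sum_insert hi,
      add_apply, ih]
    congr 1
    simp [add_comm]

/-- The covariant derivative of a section in terms of its components with respect to a frame. -/
theorem CovariantDerivative.frame_apply {φ : Π x : M, H →ₗ[ℝ] V x} {x : M} {g : M → H}
    (hφ : ∀ ξ, MDifferentiableAt 𝓘(ℝ, E) (𝓘(ℝ, E).prod 𝓘(ℝ, F))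
      (fun y => (⟨y, φ y ξ⟩ : TotalSpace F V)) x)
    (hg : MDifferentiableAt 𝓘(ℝ, E) 𝓘(ℝ, H) g x) (u : TangentSpace 𝓘(ℝ, E) x) :
    conn (fun y => φ y (g y)) x u =
      φ x (mvfderiv 𝓘(ℝ, E) g x u) + conn (fun y => φ y (g x)) x u := by
  have hc : ∀ i, MDifferentiableAt 𝓘(ℝ, E) 𝓘(ℝ, ℝ)
      (fun y => (Module.finBasis ℝ H).coord i (g y)) x := fun i =>
    (LinearMap.toContinuousLinearMap
      ((Module.finBasis ℝ H).coord i)).mdifferentiableAt.comp x hg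
  simp_rw [fun y => linearMap_apply_eq_sum (φ y) (g y), fun y => linearMap_apply_eq_sum (φ y) (g x)]
  rw [conn.sum_smul Finset.univ _ _ hc (fun i => hφ _),
    conn.sum_smul Finset.univ (fun i _ => (Module.finBasis ℝ H).coord i (g x)) _
      (fun i => mdifferentiableAt_const) (fun i => hφ _), linearMap_apply_eq_sum (φ x),
    ← Finset.sum_add_distrib]
  refine Finset.sum_congr rfl fun i _ => ?_
  have := mvfderiv_clm_comp (LinearMap.toContinuousLinearMap ((Module.finBasis ℝ H).coord i)) hg u
  simp only [LinearMap.coe_toContinuousLinearMap'] at this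
  simp only [this, mvfderiv_const, zero_apply, zero_smul, zero_add]

end Conn

end

end Frames

/-! ### Functions with vanishing derivative on a manifold -/

section LocallyConstant

variable {E : Type*} [NormedAddCommGroup E] [NormedSpace ℝ E]
  {M : Type*} [TopologicalSpace M] [ChartedSpace E M] [IsManifold 𝓘(ℝ, E) ∞ M]
  {H : Type*} [NormedAddCommGroup H] [NormedSpace ℝ H]

/-- A function on a manifold whose derivative vanishes near a point is constant near this point. -/
theorem eventually_eq_of_mvfderiv_eq_zero {g : M → H} {x : M}
    (hg : ∀ᶠ y in 𝓝 x, MDifferentiableAt 𝓘(ℝ, E) 𝓘(ℝ, H) g y)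
    (hg' : ∀ᶠ y in 𝓝 x, mvfderiv 𝓘(ℝ, E) g y = 0) : ∀ᶠ y in 𝓝 x, g y = g x := by
  have : IsManifold 𝓘(ℝ, E) 1 M := IsManifold.of_le (n := ∞) (by exact_mod_cast le_top)
  set χ := chartAt E x with hχ
  have hχs : MDifferentiableOn 𝓘(ℝ, E) 𝓘(ℝ, E) χ.symm χ.target :=
    (contMDiffOn_chart_symm (n := 1)).mdifferentiableOn one_ne_zero
  have hcont : ContinuousAt χ.symm (χ x) :=
    χ.symm.continuousAt (χ.map_source (mem_chart_source E x))
  have hxx : χ.symm (χ x) = x := χ.left_inv (mem_chart_source E x)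
  have hev : ∀ᶠ z in 𝓝 (χ x), z ∈ χ.target ∧ MDifferentiableAt 𝓘(ℝ, E) 𝓘(ℝ, H) g (χ.symm z) ∧
      mvfderiv 𝓘(ℝ, E) g (χ.symm z) = 0 := by
    refine (χ.open_target.eventually_mem (χ.map_source (mem_chart_source E x))).and ?_
    have := hcont.eventually (p := fun y => MDifferentiableAt 𝓘(ℝ, E) 𝓘(ℝ, H) g y ∧
      mvfderiv 𝓘(ℝ, E) g y = 0) (by rw [hxx]; exact hg.and hg')
    exact this
  obtain ⟨r, hr, hball⟩ := Metric.eventually_nhds_iff_ball.1 hev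
  have hd : ∀ z ∈ Metric.ball (χ x) r, HasFDerivAt (g ∘ χ.symm) (0 : E →L[ℝ] H) z := by
    intro z hz
    obtain ⟨h1, h2, h3⟩ := hball z hz
    have h4 := (hχs z h1).mdifferentiableAt (χ.open_target.mem_nhds h1)
    have h5 := h2.hasMFDerivAt.comp z h4.hasMFDerivAt
    have h6 : mfderiv 𝓘(ℝ, E) 𝓘(ℝ, H) g (χ.symm z) = 0 := h3
    rw [h6, ContinuousLinearMap.zero_comp] at h5
    exact h5.hasFDerivAt
  have hconst : ∀ z ∈ Metric.ball (χ x) r, g (χ.symm z) = g x := by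
    intro z hz
    have := Metric.isOpen_ball.is_const_of_fderiv_eq_zero (𝕜 := ℝ) (f := g ∘ χ.symm)
      (convex_ball _ _).isPreconnected
      (fun z hz => (hd z hz).differentiableAt.differentiableWithinAt)
      (fun z hz => (hd z hz).fderiv) hz (Metric.mem_ball_self hr)
    simpa [hxx] using this
  have h1 : ∀ᶠ y in 𝓝 x, χ y ∈ Metric.ball (χ x) r :=
    (χ.continuousAt (mem_chart_source E x)).eventually_mem (Metric.ball_mem_nhds _ hr)
  filter_upwards [h1, chart_source_mem_nhds E x] with y hy hys
  rw [← hconst _ hy, χ.left_inv hys]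

end LocallyConstant

/-! ### Smooth frames, parallel frames and components of sections -/

section ParallelFrames

variable {E : Type*} [NormedAddCommGroup E] [NormedSpace ℝ E]
  {M : Type*} [TopologicalSpace M] [ChartedSpace E M] [IsManifold 𝓘(ℝ, E) ∞ M]
  {F : Type*} [NormedAddCommGroup F] [NormedSpace ℝ F] [FiniteDimensional ℝ F]
  {V : M → Type*} [TopologicalSpace (TotalSpace F V)] [∀ x, TopologicalSpace (V x)]
  [FiberBundle F V] [∀ x, AddCommGroup (V x)] [∀ x, Module ℝ (V x)] [VectorBundle ℝ F V]
  [ContMDiffVectorBundle ∞ F V 𝓘(ℝ, E)]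
  {H : Type*} [NormedAddCommGroup H] [NormedSpace ℝ H] [FiniteDimensional ℝ H]

/-- Smooth sections have smooth components with respect to a smooth frame. -/
theorem exists_contMDiffAt_frame_components {φ : Π x : M, H →ₗ[ℝ] V x} {x : M} {X : Π x, V x}
    (hφ : ∀ ξ, ContMDiffAt 𝓘(ℝ, E) (𝓘(ℝ, E).prod 𝓘(ℝ, F)) ∞
      (fun y => (⟨y, φ y ξ⟩ : TotalSpace F V)) x)
    (hbij : ∀ᶠ y in 𝓝 x, Function.Bijective (φ y))
    (hX : ContMDiffAt 𝓘(ℝ, E) (𝓘(ℝ, E).prod 𝓘(ℝ, F)) ∞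
      (fun y => (⟨y, X y⟩ : TotalSpace F V)) x) :
    ∃ g : M → H, ContMDiffAt 𝓘(ℝ, E) 𝓘(ℝ, H) ∞ g x ∧ ∀ᶠ y in 𝓝 x, X y = φ y (g y) := by
  set e := trivializationAt F V x with he
  have hx : x ∈ e.baseSet := FiberBundle.mem_baseSet_trivializationAt' x
  let b := Module.finBasis ℝ H
  -- The matrix of the frame in the trivialization, summed over a basis so that smoothness is
  -- visible. The components of `X` are obtained by applying its inverse, and operator inversion is
  -- smooth at invertible maps.
  let T : M → H →L[ℝ] F := fun y => ∑ i,
    (LinearMap.toContinuousLinearMap (b.coord i)).smulRight (e ⟨y, φ y (b i)⟩).2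
  have hT : ∀ y (hy : y ∈ e.baseSet) (ξ : H), T y ξ = e.linearEquivAt ℝ y hy (φ y ξ) := by
    intro y hy ξ
    rw [linearMap_apply_eq_sum (φ y) ξ, map_sum]
    simp [T, b]
  have hTs : ContMDiffAt 𝓘(ℝ, E) 𝓘(ℝ, H →L[ℝ] F) ∞ T x := by
    refine contMDiffAt_finsetSum fun i _ => ?_
    have h1 := (e.contMDiffAt_section_iff (IB := 𝓘(ℝ, E)) (n := ∞) hx).1 (hφ (b i))
    exact ((ContinuousLinearMap.smulRightL ℝ H F
      (LinearMap.toContinuousLinearMap (b.coord i))).contMDiff.contMDiffAt.comp x h1)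
  have hinv : ∀ᶠ y in 𝓝 x, ∃ N : H ≃L[ℝ] F, (N : H →L[ℝ] F) = T y := by
    filter_upwards [hbij, e.open_baseSet.mem_nhds hx] with y hy hye
    let N := (LinearEquiv.ofBijective (φ y) hy).trans (e.linearEquivAt ℝ y hye)
    refine ⟨N.toContinuousLinearEquiv, ?_⟩
    ext ξ
    rw [hT y hye]
    rfl
  refine ⟨fun y => (T y).inverse (e ⟨y, X y⟩).2, ?_, ?_⟩
  · obtain ⟨N, hN⟩ := hinv.self_of_nhds
    have h1 : ContMDiffAt 𝓘(ℝ, E) 𝓘(ℝ, F →L[ℝ] H) ∞ (fun y => (T y).inverse) x := by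
      have : CompleteSpace H := FiniteDimensional.complete ℝ H
      have := (contDiffAt_map_inverse (n := ∞) N)
      rw [hN] at this
      exact this.contMDiffAt.comp x hTs
    exact h1.clm_apply ((e.contMDiffAt_section_iff hx).1 hX)
  · filter_upwards [hinv, e.open_baseSet.mem_nhds hx] with y hy hye
    obtain ⟨N, hN⟩ := hy
    have h2 := hT y hye (N.symm (e ⟨y, X y⟩).2)
    rw [← hN, ContinuousLinearMap.inverse_equiv]
    rw [← hN] at h2
    simp only [ContinuousLinearEquiv.coe_coe, ContinuousLinearEquiv.apply_symm_apply] at h2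
    apply (e.linearEquivAt ℝ y hye).injective
    simpa using h2

variable [∀ x, IsTopologicalAddGroup (V x)] [∀ x, ContinuousSMul ℝ (V x)]
  {conn : CovariantDerivative 𝓘(ℝ, E) F V}

/-- A smooth frame, over the set `U`, consisting of sections which are parallel over `U`. -/
structure IsParallelFrameOn (conn : CovariantDerivative 𝓘(ℝ, E) F V)
    (φ : Π x : M, H →ₗ[ℝ] V x) (U : Set M) : Prop where
  smooth : ∀ ξ, ContMDiffOn 𝓘(ℝ, E) (𝓘(ℝ, E).prod 𝓘(ℝ, F)) ∞
    (fun y => (⟨y, φ y ξ⟩ : TotalSpace F V)) U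
  bijective : ∀ x ∈ U, Function.Bijective (φ x)
  parallel : ∀ ξ, ∀ x ∈ U, conn (fun y => φ y ξ) x = 0

namespace IsParallelFrameOn

variable {φ : Π x : M, H →ₗ[ℝ] V x} {U : Set M}

theorem mono (h : IsParallelFrameOn conn φ U) {U' : Set M} (hU : U' ⊆ U) :
    IsParallelFrameOn conn φ U' :=
  ⟨fun ξ => (h.smooth ξ).mono hU, fun x hx => h.bijective x (hU hx),
    fun ξ x hx => h.parallel ξ x (hU hx)⟩

/-- A change of model space, used to replace `F` by a coordinate space in `Type`. -/
theorem comp_equiv (h : IsParallelFrameOn conn φ U) {H' : Type*} [NormedAddCommGroup H']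
    [NormedSpace ℝ H'] (N : H' ≃ₗ[ℝ] H) :
    IsParallelFrameOn conn (fun x => φ x ∘ₗ N.toLinearMap) U :=
  ⟨fun ξ => h.smooth (N ξ), fun x hx => (h.bijective x hx).comp N.bijective,
    fun ξ x hx => h.parallel (N ξ) x hx⟩

theorem contMDiffAt (h : IsParallelFrameOn conn φ U) {x : M} (hU : U ∈ 𝓝 x) (ξ : H) :
    ContMDiffAt 𝓘(ℝ, E) (𝓘(ℝ, E).prod 𝓘(ℝ, F)) ∞
      (fun y => (⟨y, φ y ξ⟩ : TotalSpace F V)) x :=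
  (h.smooth ξ).contMDiffAt hU

theorem conn_apply (h : IsParallelFrameOn conn φ U) {x : M} (hU : U ∈ 𝓝 x) {g : M → H}
    (hg : MDifferentiableAt 𝓘(ℝ, E) 𝓘(ℝ, H) g x) (u : TangentSpace 𝓘(ℝ, E) x) :
    conn (fun y => φ y (g y)) x u = φ x (mvfderiv 𝓘(ℝ, E) g x u) := by
  rw [conn.frame_apply (fun ξ => (h.contMDiffAt hU ξ).mdifferentiableAt (by simp)) hg,
    h.parallel _ x (mem_of_mem_nhds hU)]
  simp

theorem exists_components (h : IsParallelFrameOn conn φ U) {x : M} (hU : U ∈ 𝓝 x) {X : Π x, V x}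
    (hX : ContMDiffAt 𝓘(ℝ, E) (𝓘(ℝ, E).prod 𝓘(ℝ, F)) ∞
      (fun y => (⟨y, X y⟩ : TotalSpace F V)) x) :
    ∃ g : M → H, ContMDiffAt 𝓘(ℝ, E) 𝓘(ℝ, H) ∞ g x ∧ ∀ᶠ y in 𝓝 x, X y = φ y (g y) :=
  exists_contMDiffAt_frame_components (h.contMDiffAt hU)
    (Filter.mem_of_superset hU h.bijective) hX

theorem exists_components_on (h : IsParallelFrameOn conn φ U) (hU : IsOpen U) {X : Π x, V x}
    (hX : ContMDiffOn 𝓘(ℝ, E) (𝓘(ℝ, E).prod 𝓘(ℝ, F)) ∞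
      (fun y => (⟨y, X y⟩ : TotalSpace F V)) U) :
    ∃ g : M → H, ContMDiffOn 𝓘(ℝ, E) 𝓘(ℝ, H) ∞ g U ∧ ∀ y ∈ U, X y = φ y (g y) := by
  have hinv : ∀ y ∈ U, φ y (Function.invFun (φ y) (X y)) = X y := fun y hy =>
    Function.invFun_eq ((h.bijective y hy).2 _)
  -- Pointwise inversion gives one function on all of `U`. By injectivity of the frame it agrees
  -- near each point with the smooth local components.
  refine ⟨fun y => Function.invFun (φ y) (X y), fun x hx => ?_, fun y hy => (hinv y hy).symm⟩
  obtain ⟨g, hg, hgX⟩ := h.exists_components (hU.mem_nhds hx) (hX.contMDiffAt (hU.mem_nhds hx))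
  refine (hg.congr_of_eventuallyEq ?_).contMDiffWithinAt
  filter_upwards [hgX, hU.mem_nhds hx] with y hy hyU
  exact (h.bijective y hyU).1 ((hinv y hyU).trans hy)

/-- A parallel section has locally constant components with respect to a parallel frame. -/
theorem eventually_eq_of_parallel (h : IsParallelFrameOn conn φ U) {x : M} (hU : U ∈ 𝓝 x)
    {X : Π x, V x}
    (hX : ContMDiffAt 𝓘(ℝ, E) (𝓘(ℝ, E).prod 𝓘(ℝ, F)) ∞
      (fun y => (⟨y, X y⟩ : TotalSpace F V)) x)
    (hX' : ∀ᶠ y in 𝓝 x, conn X y = 0) {ξ : H} (hξ : X x = φ x ξ) :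
    ∀ᶠ y in 𝓝 x, X y = φ y ξ := by
  obtain ⟨g, hg, hgX⟩ := h.exists_components hU hX
  have hgd : ∀ᶠ y in 𝓝 x, MDifferentiableAt 𝓘(ℝ, E) 𝓘(ℝ, H) g y := by
    have h1 : ContMDiffAt 𝓘(ℝ, E) 𝓘(ℝ, H) 1 g x := hg.of_le (by exact_mod_cast le_top)
    have : IsManifold 𝓘(ℝ, E) 1 M := IsManifold.of_le (n := ∞) (by exact_mod_cast le_top)
    filter_upwards [(contMDiffAt_iff_contMDiffAt_nhds (by simp)).1 h1] with y hy
    exact hy.mdifferentiableAt one_ne_zero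
  -- In a parallel frame `∇X` is `φ` applied to the derivative of `g`, so injectivity of `φ` forces
  -- this derivative to vanish.
  have hg' : ∀ᶠ y in 𝓝 x, mvfderiv 𝓘(ℝ, E) g y = 0 := by
    filter_upwards [eventually_mem_nhds_iff.2 hU, hgd, hX', eventually_eventually_nhds.2 hgX] with
      y hUy hy hXy hgXy
    ext u
    apply (h.bijective y (mem_of_mem_nhds hUy)).1
    have hm : MDifferentiableAt 𝓘(ℝ, E) (𝓘(ℝ, E).prod 𝓘(ℝ, F))
        (fun y => (⟨y, φ y (g y)⟩ : TotalSpace F V)) y :=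
      MDifferentiableAt.frame_apply
        (fun ξ => (h.contMDiffAt hUy ξ).mdifferentiableAt (by simp)) hy
    rw [← h.conn_apply hUy hy u, conn.congr_germ hm (hgXy.mono fun _ h => h.symm), hXy]
    simp
  have hgx : g x = ξ :=
    (h.bijective x (mem_of_mem_nhds hU)).1 (hgX.self_of_nhds.symm.trans hξ)
  filter_upwards [eventually_eq_of_mvfderiv_eq_zero hgd hg', hgX] with y h1 h2
  rw [h2, h1, hgx]

/-- A parallel section over a connected open set has constant components with respect to a
parallel frame. -/
theorem eqOn_of_parallel (h : IsParallelFrameOn conn φ U) (hU : IsOpen U)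
    (hconn : IsPreconnected U) {X : Π x, V x}
    (hX : ContMDiffOn 𝓘(ℝ, E) (𝓘(ℝ, E).prod 𝓘(ℝ, F)) ∞
      (fun y => (⟨y, X y⟩ : TotalSpace F V)) U)
    (hX' : ∀ y ∈ U, conn X y = 0) {ξ : H} {x₀ : M} (hx₀ : x₀ ∈ U) (hξ : X x₀ = φ x₀ ξ) :
    ∀ y ∈ U, X y = φ y ξ := by
  have key : ∀ x ∈ U, ∀ η, X x = φ x η → ∀ᶠ y in 𝓝 x, X y = φ y η := fun x hx η hη =>
    h.eventually_eq_of_parallel (hU.mem_nhds hx) (hX.contMDiffAt (hU.mem_nhds hx))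
      (Filter.mem_of_superset (hU.mem_nhds hx) hX') hη
  refine fun y hy => hconn.induction₂' (fun x y => X x = φ x ξ → X y = φ y ξ) (fun x hx => ?_)
    (fun x y z _ _ _ h1 h2 h3 => h2 (h1 h3)) hx₀ hy hξ
  -- Near `x` the section is `φ η`, so agreement with `φ ξ` at a nearby point means `η = ξ`,
  -- whichever point is taken. The agreement set is therefore open and closed in `U`.
  obtain ⟨η, hη⟩ := (h.bijective x hx).2 (X x)
  refine nhdsWithin_le_nhds ?_
  filter_upwards [key x hx η hη.symm, hU.mem_nhds hx] with y hy hyU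
  have h1 : X x = φ x ξ ↔ η = ξ := by rw [← hη]; exact (h.bijective x hx).1.eq_iff
  have h2 : X y = φ y ξ ↔ η = ξ := by rw [hy]; exact (h.bijective y hyU).1.eq_iff
  rw [h1, h2]
  exact ⟨id, id⟩

end IsParallelFrameOn

end ParallelFrames

/-! ### Vector fields as derivations -/

section Commutator

variable {E : Type*} [NormedAddCommGroup E] [NormedSpace ℝ E] [FiniteDimensional ℝ E]
  {M : Type*} [TopologicalSpace M] [T2Space M] [ChartedSpace E M] [IsManifold 𝓘(ℝ, E) ∞ M]
  {H : Type*} [NormedAddCommGroup H] [NormedSpace ℝ H] [FiniteDimensional ℝ H]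

/-- A function which is smooth on an open set agrees near each point of that set with a global
smooth function. -/
theorem exists_contMDiff_eventuallyEq {U : Set M} (hU : IsOpen U) {x : M} (hx : x ∈ U) {g : M → H}
    (hg : ContMDiffOn 𝓘(ℝ, E) 𝓘(ℝ, H) ∞ g U) :
    ∃ G : M → H, ContMDiff 𝓘(ℝ, E) 𝓘(ℝ, H) ∞ G ∧ ∀ᶠ y in 𝓝 x, G y = g y := by
  obtain ⟨f, -, hf⟩ := (SmoothBumpFunction.nhds_basis_tsupport (I := 𝓘(ℝ, E)) x).mem_iff.1
    (hU.mem_nhds hx)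
  refine ⟨fun y => f y • g y, contMDiff_of_tsupport fun y hy => ?_, ?_⟩
  · have hyU : y ∈ U := hf (tsupport_smul_subset_left _ _ hy)
    exact f.contMDiff.contMDiffAt.smul (hg.contMDiffAt (hU.mem_nhds hyU))
  · filter_upwards [f.eventuallyEq_one] with y hy
    simp [hy]

theorem SmoothVectorField.contMDiff_mvfderiv (W : SmoothVectorField E M) {f : M → H}
    (hf : ContMDiff 𝓘(ℝ, E) 𝓘(ℝ, H) ∞ f) :
    ContMDiff 𝓘(ℝ, E) 𝓘(ℝ, H) ∞ (fun y => mvfderiv 𝓘(ℝ, E) f y (W y)) := by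
  have h1 : ContMDiff 𝓘(ℝ, E).tangent 𝓘(ℝ, H).tangent ∞ (tangentMap 𝓘(ℝ, E) 𝓘(ℝ, H) f) :=
    hf.contMDiff_tangentMap (by simp)
  exact (contMDiff_snd_tangentBundle_modelSpace H 𝓘(ℝ, H)).comp (h1.comp W.contMDiff)

theorem SmoothVectorField.exists_apply_eq (x : M) (v : TangentSpace 𝓘(ℝ, E) x) :
    ∃ Z : SmoothVectorField E M, Z x = v := by
  obtain ⟨u, hu, hσ⟩ := FiberBundle.exists_contMDiffOn_extend (I := 𝓘(ℝ, E)) (F := E) (k := ∞) v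
  obtain ⟨Z, hZ⟩ := exists_contMDiffSection_eventuallyEq (V := TangentSpace 𝓘(ℝ, E)) isOpen_interior
    (mem_interior_iff_mem_nhds.2 hu) (hσ.mono interior_subset)
  exact ⟨Z, by simpa using hZ.self_of_nhds⟩

theorem SmoothVectorField.lie_smul_apply (W Z : SmoothVectorField E M) {f : M → ℝ} {x : M}
    (hf : MDifferentiableAt 𝓘(ℝ, E) 𝓘(ℝ, ℝ) f x) :
    mlieBracket 𝓘(ℝ, E) W (fun y => f y • Z y) x =
      mvfderiv 𝓘(ℝ, E) f x (W x) • Z x + f x • W.lie Z x :=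
  mlieBracket_smul_right hf Z.mdifferentiableAt

/-- The Lie bracket of vector fields acts on functions as the commutator of derivations. -/
theorem SmoothVectorField.mvfderiv_lie_apply_real (U W : SmoothVectorField E M) {f : M → ℝ}
    (hf : ContMDiff 𝓘(ℝ, E) 𝓘(ℝ, ℝ) ∞ f) (x : M) :
    mvfderiv 𝓘(ℝ, E) (fun y => mvfderiv 𝓘(ℝ, E) f y (W y)) x (U x)
      - mvfderiv 𝓘(ℝ, E) (fun y => mvfderiv 𝓘(ℝ, E) f y (U y)) x (W x)
      = mvfderiv 𝓘(ℝ, E) f x (U.lie W x) := by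
  rcases subsingleton_or_nontrivial E with hE | hE
  · have h0 : ∀ v : TangentSpace 𝓘(ℝ, E) x, v = 0 := fun v => Subsingleton.elim (α := E) _ _
    rw [h0 (U x), h0 (W x), h0 (U.lie W x)]
    simp
  -- Test the Jacobi identity on `U`, `W` and `f Z` with `Z x ≠ 0`. After Leibniz expansion the
  -- mixed terms cancel, the terms in `f` cancel by Jacobi for `Z`, and the coefficient of `Z x` is
  -- the claim. This avoids coordinates.
  obtain ⟨v, hv⟩ := exists_ne (0 : E)
  obtain ⟨Z, hZ⟩ := SmoothVectorField.exists_apply_eq (E := E) x (v : TangentSpace 𝓘(ℝ, E) x)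
  have : IsManifold 𝓘(ℝ, E) (minSmoothness ℝ 3) M := by
    rw [minSmoothness_of_isRCLikeNormedField]; infer_instance
  have hsm : ∀ X : SmoothVectorField E M, ContMDiffAt 𝓘(ℝ, E) 𝓘(ℝ, E).tangent (minSmoothness ℝ 2)
      (fun y => (⟨y, X y⟩ : TangentBundle 𝓘(ℝ, E) M)) x := fun X => by
    rw [minSmoothness_of_isRCLikeNormedField]
    exact X.contMDiff.contMDiffAt.of_le (by decide)
  have hfd : ∀ {h : M → ℝ}, ContMDiff 𝓘(ℝ, E) 𝓘(ℝ, ℝ) ∞ h →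
      ∀ y, MDifferentiableAt 𝓘(ℝ, E) 𝓘(ℝ, ℝ) h y := fun hh y =>
    hh.contMDiffAt.mdifferentiableAt (by simp)
  have jac : ∀ Z : SmoothVectorField E M, U.lie (W.lie Z) x =
      (U.lie W).lie Z x + W.lie (U.lie Z) x := fun Z =>
    leibniz_identity_mlieBracket_apply (hsm U) (hsm W) (hsm Z)
  have expand : ∀ U W : SmoothVectorField E M, U.lie (W.lie (smoothFunSmul ⟨f, hf⟩ Z)) x =
      (mvfderiv 𝓘(ℝ, E) (fun y => mvfderiv 𝓘(ℝ, E) f y (W y)) x (U x) • Z x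
        + mvfderiv 𝓘(ℝ, E) f x (W x) • U.lie Z x)
      + (mvfderiv 𝓘(ℝ, E) f x (U x) • W.lie Z x + f x • U.lie (W.lie Z) x) := by
    intro U W
    set h : C^∞⟮𝓘(ℝ, E), M; ℝ⟯ := ⟨_, W.contMDiff_mvfderiv hf⟩ with hh
    have e1 : W.lie (smoothFunSmul ⟨f, hf⟩ Z)
        = smoothFunSmul h Z + smoothFunSmul ⟨f, hf⟩ (W.lie Z) := by
      ext y
      exact W.lie_smul_apply Z (hfd hf y)
    rw [e1]
    refine (mlieBracket_add_right (V := U) (W := smoothFunSmul h Z)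
      (W₁ := smoothFunSmul ⟨f, hf⟩ (W.lie Z)) (ContMDiffSection.mdifferentiableAt _)
      (ContMDiffSection.mdifferentiableAt _)).trans ?_
    exact congrArg₂ _ (U.lie_smul_apply Z (hfd h.contMDiff x))
      (U.lie_smul_apply (W.lie Z) (hfd hf x))
  have e3 : (U.lie W).lie (smoothFunSmul ⟨f, hf⟩ Z) x =
      mvfderiv 𝓘(ℝ, E) f x (U.lie W x) • Z x + f x • (U.lie W).lie Z x :=
    (U.lie W).lie_smul_apply Z (hfd hf x)
  have key := jac (smoothFunSmul ⟨f, hf⟩ Z)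
  rw [expand U W, expand W U, e3, jac Z] at key
  have h4 : (mvfderiv 𝓘(ℝ, E) (fun y => mvfderiv 𝓘(ℝ, E) f y (W y)) x (U x)
      - mvfderiv 𝓘(ℝ, E) (fun y => mvfderiv 𝓘(ℝ, E) f y (U y)) x (W x)
      - mvfderiv 𝓘(ℝ, E) f x (U.lie W x)) • Z x = 0 := by
    rw [← sub_eq_zero.2 key]
    module
  rw [hZ] at h4
  have h5 := (smul_eq_zero.1 h4).resolve_right hv
  linarith

theorem SmoothVectorField.mvfderiv_lie_apply (U W : SmoothVectorField E M) {f : M → H}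
    (hf : ContMDiff 𝓘(ℝ, E) 𝓘(ℝ, H) ∞ f) (x : M) :
    mvfderiv 𝓘(ℝ, E) (fun y => mvfderiv 𝓘(ℝ, E) f y (W y)) x (U x)
      - mvfderiv 𝓘(ℝ, E) (fun y => mvfderiv 𝓘(ℝ, E) f y (U y)) x (W x)
      = mvfderiv 𝓘(ℝ, E) f x (U.lie W x) := by
  refine (SeparatingDual.eq_iff_forall_dual_eq (R := ℝ)).2 fun ℓ => ?_
  have hfd : ∀ {h : M → H}, ContMDiff 𝓘(ℝ, E) 𝓘(ℝ, H) ∞ h →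
      ∀ y, MDifferentiableAt 𝓘(ℝ, E) 𝓘(ℝ, H) h y := fun hh y =>
    hh.contMDiffAt.mdifferentiableAt (by simp)
  have := U.mvfderiv_lie_apply_real W (ℓ.contMDiff.comp hf) x
  simp only [Function.comp_def, mvfderiv_clm_comp ℓ (hfd hf _)] at this
  rw [mvfderiv_clm_comp ℓ (hfd (W.contMDiff_mvfderiv hf) x),
    mvfderiv_clm_comp ℓ (hfd (U.contMDiff_mvfderiv hf) x)] at this
  rw [map_sub, this]

end Commutator

/-! ### From parallel frames to flatness and action algebroids -/

section Algebroid

variable {E : Type*} [NormedAddCommGroup E] [NormedSpace ℝ E] [FiniteDimensional ℝ E]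
  {M : Type*} [TopologicalSpace M] [T2Space M] [ChartedSpace E M] [IsManifold 𝓘(ℝ, E) ∞ M]
  {F : Type*} [NormedAddCommGroup F] [NormedSpace ℝ F] [FiniteDimensional ℝ F]
  {V : M → Type*} [TopologicalSpace (TotalSpace F V)] [∀ x, TopologicalSpace (V x)]
  [FiberBundle F V] [∀ x, AddCommGroup (V x)] [∀ x, Module ℝ (V x)] [VectorBundle ℝ F V]
  [ContMDiffVectorBundle ∞ F V 𝓘(ℝ, E)]

namespace LieAlgebroid

variable (A : LieAlgebroid E F V)

theorem bracket_sum_smul_right {ι : Type*} (t : Finset ι) (X : Cₛ^∞⟮𝓘(ℝ, E); F, V⟯)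
    (f : ι → C^∞⟮𝓘(ℝ, E), M; ℝ⟯) (S : ι → Cₛ^∞⟮𝓘(ℝ, E); F, V⟯) (x : M) :
    A.bracket X (∑ i ∈ t, smoothFunSmul (f i) (S i)) x =
      ∑ i ∈ t, (f i x • A.bracket X (S i) x
        + mvfderiv 𝓘(ℝ, E) (f i) x (A.anchor x (X x)) • S i x) := by
  classical
  induction t using Finset.induction_on with
  | empty => simp
  | insert i t hi ih =>
    rw [Finset.sum_insert hi, Finset.sum_insert hi, map_add, ContMDiffSection.coe_add,
      Pi.add_apply, ih, A.leibniz]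

theorem bracket_sum_smul_left {ι : Type*} (t : Finset ι) (Y : Cₛ^∞⟮𝓘(ℝ, E); F, V⟯)
    (f : ι → C^∞⟮𝓘(ℝ, E), M; ℝ⟯) (S : ι → Cₛ^∞⟮𝓘(ℝ, E); F, V⟯) (x : M) :
    A.bracket (∑ i ∈ t, smoothFunSmul (f i) (S i)) Y x =
      ∑ i ∈ t, (f i x • A.bracket (S i) Y x
        - mvfderiv 𝓘(ℝ, E) (f i) x (A.anchor x (Y x)) • S i x) := by
  rw [A.bracket_skew, ContMDiffSection.coe_neg, Pi.neg_apply, A.bracket_sum_smul_right,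
    ← Finset.sum_neg_distrib]
  refine Finset.sum_congr rfl fun i _ => ?_
  rw [A.bracket_skew (S i) Y, ContMDiffSection.coe_neg, Pi.neg_apply]
  module

end LieAlgebroid

theorem mvfderiv_congr {H : Type*} [NormedAddCommGroup H] [NormedSpace ℝ H] {f g : M → H} {x : M}
    (h : ∀ᶠ y in 𝓝 x, f y = g y) : mvfderiv 𝓘(ℝ, E) f x = mvfderiv 𝓘(ℝ, E) g x :=
  Filter.EventuallyEq.mfderiv_eq h

theorem ContMDiffSection.sum_apply {ι : Type*} (t : Finset ι) (S : ι → Cₛ^∞⟮𝓘(ℝ, E); F, V⟯)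
    (x : M) : (∑ i ∈ t, S i) x = ∑ i ∈ t, S i x := by
  classical
  induction t using Finset.induction_on with
  | empty => simp
  | insert i t hi ih =>
    rw [Finset.sum_insert hi, Finset.sum_insert hi, ContMDiffSection.coe_add, Pi.add_apply, ih]

namespace CartanAlgebroid

variable [∀ x, IsTopologicalAddGroup (V x)] [∀ x, ContinuousSMul ℝ (V x)]
  (A : CartanAlgebroid E F V)

/-- The curvature vanishes wherever there are enough parallel sections. -/
theorem isFlat_of_isParallelFrameOn {H : Type*} [NormedAddCommGroup H] [NormedSpace ℝ H]
    [FiniteDimensional ℝ H]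
    (h : ∀ x : M, ∃ U : Set M, IsOpen U ∧ x ∈ U ∧
      ∃ φ : Π x : M, H →ₗ[ℝ] V x, IsParallelFrameOn A.conn φ U) : A.IsFlat := by
  intro U W X
  ext x
  obtain ⟨O, hO, hxO, φ, hφ⟩ := h x
  obtain ⟨g, hg, hgX⟩ := hφ.exists_components_on hO X.contMDiff.contMDiffOn
  -- The commutator formula is stated for global smooth functions; only the germ at `x` matters.
  obtain ⟨G, hG, hGg⟩ := exists_contMDiff_eventuallyEq hO hxO hg
  have hGX : ∀ᶠ y in 𝓝 x, X y = φ y (G y) := by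
    filter_upwards [hO.mem_nhds hxO, hGg] with y hy h1
    rw [hgX y hy, h1]
  have hd : ∀ {k : M → H}, ContMDiff 𝓘(ℝ, E) 𝓘(ℝ, H) ∞ k →
      ∀ y, MDifferentiableAt 𝓘(ℝ, E) 𝓘(ℝ, H) k y := fun hh y =>
    hh.contMDiffAt.mdifferentiableAt (by simp)
  have hnabla : ∀ (Y : Cₛ^∞⟮𝓘(ℝ, E); F, V⟯) (k : M → H), ContMDiff 𝓘(ℝ, E) 𝓘(ℝ, H) ∞ k →
      (∀ᶠ y in 𝓝 x, Y y = φ y (k y)) → ∀ Z : SmoothVectorField E M,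
      ∀ᶠ y in 𝓝 x, A.nabla Z Y y = φ y (mvfderiv 𝓘(ℝ, E) k y (Z y)) := by
    intro Y k hk hY Z
    filter_upwards [eventually_eventually_nhds.2 hY, hO.mem_nhds hxO] with y hy hyO
    rw [← hφ.conn_apply (hO.mem_nhds hyO) (hd hk y)]
    exact DFunLike.congr_fun (A.conn.congr_germ Y.mdifferentiableAt hy) (Z y)
  have h2 : ∀ Z Z' : SmoothVectorField E M, A.nabla Z (A.nabla Z' X) x =
      φ x (mvfderiv 𝓘(ℝ, E) (fun y => mvfderiv 𝓘(ℝ, E) G y (Z' y)) x (Z x)) := fun Z Z' =>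
    (hnabla _ _ (Z'.contMDiff_mvfderiv hG) (hnabla X G hG hGX Z') Z).self_of_nhds
  simp only [ContMDiffSection.coe_sub, Pi.sub_apply, ContMDiffSection.coe_zero, Pi.zero_apply]
  rw [h2 U W, h2 W U, (hnabla X G hG hGX (U.lie W)).self_of_nhds, ← U.mvfderiv_lie_apply W hG x]
  simp

/-- Constant sections of the action algebroid are parallel. Since the Lie algebra may change with
`U`, it is identified with `F` through the fibre at `x`, giving all local frames one model space. -/
theorem IsSymmetricOn.exists_isParallelFrameOn {A : CartanAlgebroid E F V} {U : Set M}
    (h : A.IsSymmetricOn U) {x : M} (hx : x ∈ U) :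
    ∃ φ : Π x : M, F →ₗ[ℝ] V x, IsParallelFrameOn A.conn φ U := by
  obtain ⟨G, _, _, _, ρ, φ, hφ⟩ := h
  let N₁ : G ≃ₗ[ℝ] F := (LinearEquiv.ofBijective (φ x) (hφ.bijective x hx)).trans
    ((trivializationAt F V x).linearEquivAt ℝ x (FiberBundle.mem_baseSet_trivializationAt' x))
  have hc : ∀ ξ : G, SmoothVecOn E (fun _ : M => ξ) U := fun ξ ℓ => contMDiffOn_const
  refine ⟨fun y => φ y ∘ₗ N₁.symm.toLinearMap, fun ξ => hφ.smooth _ (hc (N₁.symm ξ)),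
    fun y hy => (hφ.bijective y hy).comp N₁.symm.bijective, fun ξ y hy => ?_⟩
  ext u
  refine (hφ.conn_eq _ (hc (N₁.symm ξ)) y hy u).trans ?_
  simp [flatDeriv, mvfderiv_const]

/-- A frame of parallel sections which is compatible with anchors and brackets is an isomorphism
from an action algebroid. -/
theorem isActionIsoOn_of_parallel {A : CartanAlgebroid E F V} {G : Type*} [LieRing G]
    [LieAlgebra ℝ G] [Module.Finite ℝ G] {U : Set M} (hU : IsOpen U)
    {ρ : LieAlgebraActionOn E G U} {φ : Π x : M, G →ₗ[ℝ] V x}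
    (smooth : ∀ ξ, ContMDiffOn 𝓘(ℝ, E) (𝓘(ℝ, E).prod 𝓘(ℝ, F)) ∞
      (fun y => (⟨y, φ y ξ⟩ : TotalSpace F V)) U)
    (bijective : ∀ x ∈ U, Function.Bijective (φ x))
    (parallel : ∀ ξ, ∀ x ∈ U, A.conn (fun y => φ y ξ) x = 0)
    (anchor_eq : ∀ x ∈ U, ∀ ξ : G, A.anchor x (φ x ξ) = ρ.anchor x ξ)
    (bracket_eq : ∀ ξ η : G, ∀ x ∈ U,
      A.localBracket (fun y => φ y ξ) (fun y => φ y η) x = φ x ⁅ξ, η⁆) :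
    A.IsActionIsoOn ρ φ := by
  have hdiff : ∀ {X : M → G}, SmoothVecOn E X U → ∀ x ∈ U, ∀ i,
      MDifferentiableAt 𝓘(ℝ, E) 𝓘(ℝ, ℝ) (fun y => (Module.finBasis ℝ G).coord i (X y)) x :=
    fun hX x hx i => ((hX _).contMDiffAt (hU.mem_nhds hx)).mdifferentiableAt (by simp)
  refine ⟨fun X hX => ?_, bijective, anchor_eq, fun X hX x hx u => ?_, fun X Y hX hY x hx => ?_⟩
  · simp_rw [fun y => linearMap_apply_eq_sum (φ y) (X y)]
    exact ContMDiffOn.sum_section fun i _ => (hX _).smul_section (smooth _)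
  · simp_rw [fun y => linearMap_apply_eq_sum (φ y) (X y)]
    rw [A.conn.sum_smul Finset.univ _ _ (hdiff hX x hx)
      (fun i => ((smooth _).contMDiffAt (hU.mem_nhds hx)).mdifferentiableAt (by simp))]
    simp [flatDeriv, parallel _ x hx]
  -- The algebroid bracket acts on global sections, so basis sections and coefficients are extended
  -- from their germs at `x`. Expanding by Leibniz in both arguments gives three groups of terms,
  -- matching `∇_{#X} Y`, `-∇_{#Y} X` and `τ(X, Y)`.
  · set b := Module.finBasis ℝ G with hb
    have hS : ∀ i, ∃ S : Cₛ^∞⟮𝓘(ℝ, E); F, V⟯, ∀ᶠ y in 𝓝 x, S y = φ y (b i) := fun i =>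
      exists_contMDiffSection_eventuallyEq hU hx (smooth (b i))
    choose S hS using hS
    have hf : ∀ {X : M → G}, SmoothVecOn E X U → ∃ f : Fin (Module.finrank ℝ G) →
        C^∞⟮𝓘(ℝ, E), M; ℝ⟯, ∀ i, ∀ᶠ y in 𝓝 x, f i y = b.coord i (X y) := by
      intro X hX
      choose f hf hf' using fun i => exists_contMDiff_eventuallyEq hU hx (hX (b.coord i))
      exact ⟨fun i => ⟨f i, hf i⟩, hf'⟩
    have hsum : ∀ {X : M → G} {f : Fin (Module.finrank ℝ G) → C^∞⟮𝓘(ℝ, E), M; ℝ⟯},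
        (∀ i, ∀ᶠ y in 𝓝 x, f i y = b.coord i (X y)) →
        ∀ᶠ y in 𝓝 x, (∑ i, smoothFunSmul (f i) (S i)) y = φ y (X y) := by
      intro X f hf
      filter_upwards [Filter.eventually_all.2 hf, Filter.eventually_all.2 hS] with y h1 h2
      rw [ContMDiffSection.sum_apply, linearMap_apply_eq_sum (φ y) (X y)]
      refine Finset.sum_congr rfl fun i _ => ?_
      rw [← h1, ← h2]
      rfl
    obtain ⟨f, hf'⟩ := hf hX
    obtain ⟨h, hh'⟩ := hf hY
    have hX' := hsum hf'
    have hY' := hsum hh'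
    have hbr : ∀ i j, A.bracket (S i) (S j) x = φ x ⁅b i, b j⁆ := fun i j => by
      rw [← bracket_eq _ _ x hx, A.localBracket_eq (S i) (S j) (hS i) (hS j)]
    have hflat : ∀ {X : M → G} {f : Fin (Module.finrank ℝ G) → C^∞⟮𝓘(ℝ, E), M; ℝ⟯},
        (∀ i, ∀ᶠ y in 𝓝 x, f i y = b.coord i (X y)) → ∀ u,
        ∑ i, mvfderiv 𝓘(ℝ, E) (f i) x u • S i x = φ x (flatDeriv X x u) := by
      intro X f hf u
      rw [flatDeriv, map_sum]
      refine Finset.sum_congr rfl fun i _ => ?_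
      rw [map_smul, (hS i).self_of_nhds]
      congr 2
      exact mvfderiv_congr (hf i)
    rw [A.localBracket_eq _ _ hX' hY', A.bracket_sum_smul_right, Finset.sum_add_distrib,
      hflat hh', hX'.self_of_nhds, anchor_eq x hx]
    simp_rw [A.bracket_sum_smul_left, Finset.sum_sub_distrib, smul_sub, Finset.sum_sub_distrib]
    have hY0 : Y x = ∑ j, h j x • b j := by
      conv_lhs => rw [← b.sum_repr (Y x)]
      exact Finset.sum_congr rfl fun j _ => by rw [(hh' j).self_of_nhds, b.coord_apply]
    have hX0 : X x = ∑ j, f j x • b j := by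
      conv_lhs => rw [← b.sum_repr (X x)]
      exact Finset.sum_congr rfl fun j _ => by rw [(hf' j).self_of_nhds, b.coord_apply]
    have e1 : ∑ j, h j x • ∑ i, f i x • A.bracket (S i) (S j) x = φ x ⁅X x, Y x⁆ := by
      rw [hX0, hY0]
      simp only [hbr, lie_sum, sum_lie, lie_smul, smul_lie, map_sum, map_smul, Finset.smul_sum]
    have e2 : ∑ j, h j x • ∑ i, mvfderiv 𝓘(ℝ, E) (f i) x (A.anchor x (S j x)) • S i x =
        φ x (flatDeriv X x (ρ.anchor x (Y x))) := by
      rw [← hflat hf', ← anchor_eq x hx, hY0]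
      simp only [map_sum, map_smul, Finset.smul_sum, Finset.sum_smul, smul_assoc]
      rw [Finset.sum_comm]
      exact Finset.sum_congr rfl fun i _ => Finset.sum_congr rfl fun j _ => by
        rw [(hS j).self_of_nhds]
    rw [e1, e2, LieAlgebraActionOn.bracket]
    simp only [map_add, map_sub]
    abel

end CartanAlgebroid

end Algebroid

/-! ### The Lie algebra structure on parallel sections -/

section Symmetric

variable {E : Type*} [NormedAddCommGroup E] [NormedSpace ℝ E] [FiniteDimensional ℝ E]
  {M : Type*} [TopologicalSpace M] [T2Space M] [ChartedSpace E M] [IsManifold 𝓘(ℝ, E) ∞ M]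
  {F : Type*} [NormedAddCommGroup F] [NormedSpace ℝ F] [FiniteDimensional ℝ F]
  {V : M → Type*} [TopologicalSpace (TotalSpace F V)] [∀ x, TopologicalSpace (V x)]
  [FiberBundle F V] [∀ x, AddCommGroup (V x)] [∀ x, Module ℝ (V x)] [VectorBundle ℝ F V]
  [ContMDiffVectorBundle ∞ F V 𝓘(ℝ, E)]
  [∀ x, IsTopologicalAddGroup (V x)] [∀ x, ContinuousSMul ℝ (V x)]

namespace CartanAlgebroid

variable {A : CartanAlgebroid E F V}

theorem conn_eq_zero_of_forall_nabla {X : Cₛ^∞⟮𝓘(ℝ, E); F, V⟯} {x : M}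
    (h : ∀ Z : SmoothVectorField E M, A.nabla Z X x = 0) : A.conn X x = 0 := by
  ext u
  obtain ⟨Z, rfl⟩ := SmoothVectorField.exists_apply_eq x u
  exact h Z

theorem conn_eq_zero_of_mem {X : Cₛ^∞⟮𝓘(ℝ, E); F, V⟯} (hX : X ∈ A.parallelSections) (x : M) :
    A.conn X x = 0 :=
  conn_eq_zero_of_forall_nabla fun Z => by rw [hX Z]; rfl

theorem mem_parallelSections {X : Cₛ^∞⟮𝓘(ℝ, E); F, V⟯} (hX : ∀ x, A.conn X x = 0) :
    X ∈ A.parallelSections := by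
  intro Z
  ext x
  change A.conn X x (Z x) = 0
  rw [hX x]
  rfl

/-- The bracket of sections which are parallel near a point is parallel at this point. -/
theorem conn_bracket_eq_zero {S T : Cₛ^∞⟮𝓘(ℝ, E); F, V⟯} {x : M}
    (hS : ∀ᶠ y in 𝓝 x, A.conn S y = 0) (hT : ∀ᶠ y in 𝓝 x, A.conn T y = 0) :
    A.conn (A.bracket S T) x = 0 := by
  refine conn_eq_zero_of_forall_nabla fun Z => ?_
  have key : ∀ {S : Cₛ^∞⟮𝓘(ℝ, E); F, V⟯}, (∀ᶠ y in 𝓝 x, A.conn S y = 0) →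
      ∀ Z : SmoothVectorField E M, ∀ᶠ y in 𝓝 x, covSection A.conn A.smooth_conn Z S y =
        (0 : Cₛ^∞⟮𝓘(ℝ, E); F, V⟯) y := by
    intro S hS Z
    filter_upwards [hS] with y hy
    change A.conn S y (Z y) = 0
    rw [hy]
    rfl
  -- The Cartan condition enters here: every term on its right-hand side contains a derivative of
  -- `S` or `T` that vanishes near `x`, and the bracket is local.
  have h := DFunLike.congr_fun (A.compat S T Z) x
  simp only [ContMDiffSection.coe_add, ContMDiffSection.coe_sub, Pi.add_apply, Pi.sub_apply] at h
  rw [A.bracket_congr (key hS Z) (Filter.Eventually.of_forall fun _ => rfl),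
    A.bracket_congr (Filter.Eventually.of_forall fun _ => rfl) (key hT Z),
    (key hS _).self_of_nhds, (key hT _).self_of_nhds] at h
  change covSection A.conn A.smooth_conn Z (A.bracket S T) x = 0
  simpa using h

section Frame

variable {H : Type*} [NormedAddCommGroup H] [NormedSpace ℝ H] [FiniteDimensional ℝ H]
  {φ : Π x : M, H →ₗ[ℝ] V x} {U : Set M}

theorem conn_eventually_eq_zero (hφ : IsParallelFrameOn A.conn φ U) {x : M} (hU : U ∈ 𝓝 x)
    {S : Cₛ^∞⟮𝓘(ℝ, E); F, V⟯} {ξ : H} (hS : ∀ᶠ y in 𝓝 x, S y = φ y ξ) :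
    ∀ᶠ y in 𝓝 x, A.conn S y = 0 := by
  filter_upwards [eventually_eventually_nhds.2 hS, hU] with y hy hyU
  rw [A.conn.congr_germ S.mdifferentiableAt hy, hφ.parallel _ y hyU]

/-- The bracket of two frame sections is again parallel, hence constant in the frame because `U` is
connected. The vector `ζ` will be the bracket of `ξ` and `η` in the model space. -/
theorem exists_localBracket_eq (hφ : IsParallelFrameOn A.conn φ U) (hU : IsOpen U)
    (hconn : IsPreconnected U) {x₀ : M} (hx₀ : x₀ ∈ U) (ξ η : H) :
    ∃ ζ : H, ∀ x ∈ U, A.localBracket (fun y => φ y ξ) (fun y => φ y η) x = φ x ζ := by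
  have hext : ∀ x ∈ U, ∃ Z : Cₛ^∞⟮𝓘(ℝ, E); F, V⟯, A.conn Z x = 0 ∧
      ∀ᶠ y in 𝓝 x, A.localBracket (fun y => φ y ξ) (fun y => φ y η) y = Z y := by
    intro x hx
    obtain ⟨S, hS⟩ := exists_contMDiffSection_eventuallyEq hU hx (hφ.smooth ξ)
    obtain ⟨T, hT⟩ := exists_contMDiffSection_eventuallyEq hU hx (hφ.smooth η)
    refine ⟨A.bracket S T, conn_bracket_eq_zero (conn_eventually_eq_zero hφ (hU.mem_nhds hx) hS)
      (conn_eventually_eq_zero hφ (hU.mem_nhds hx) hT), ?_⟩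
    filter_upwards [eventually_eventually_nhds.2 hS, eventually_eventually_nhds.2 hT] with y h1 h2
    exact A.localBracket_eq S T h1 h2
  obtain ⟨ζ, hζ⟩ := (hφ.bijective x₀ hx₀).2
    (A.localBracket (fun y => φ y ξ) (fun y => φ y η) x₀)
  refine ⟨ζ, hφ.eqOn_of_parallel hU hconn (fun x hx => ?_) (fun x hx => ?_) hx₀ hζ.symm⟩
  · obtain ⟨Z, -, hZ⟩ := hext x hx
    refine (Z.contMDiff.contMDiffAt.congr_of_eventuallyEq ?_).contMDiffWithinAt
    filter_upwards [hZ] with y hy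
    rw [hy]
  · obtain ⟨Z, hZ0, hZ⟩ := hext x hx
    rw [← A.conn.congr_germ Z.mdifferentiableAt (hZ.mono fun _ h => h.symm), hZ0]

end Frame

/-- A Cartan algebroid with a parallel frame over a connected open set is symmetric there. -/
theorem isSymmetricOn_of_isParallelFrameOn {H : Type} [NormedAddCommGroup H] [NormedSpace ℝ H]
    [FiniteDimensional ℝ H] {φ : Π x : M, H →ₗ[ℝ] V x} {U : Set M}
    (hφ : IsParallelFrameOn A.conn φ U) (hU : IsOpen U) (hconn : IsPreconnected U)
    {x₀ : M} (hx₀ : x₀ ∈ U) : A.IsSymmetricOn U := by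
  choose br hbr using exists_localBracket_eq hφ hU hconn hx₀
  -- Each `ξ` is represented by a global section with the germ of `φ ξ` at `x₀`. Germs determine
  -- vectors and `br` corresponds to the algebroid bracket, so the Lie algebra axioms are inherited
  -- from global sections.
  choose S hS using fun ξ => exists_contMDiffSection_eventuallyEq hU hx₀ (hφ.smooth ξ)
  have hglob : ∀ {X Y : Cₛ^∞⟮𝓘(ℝ, E); F, V⟯} {ξ η : H}, (∀ᶠ y in 𝓝 x₀, X y = φ y ξ) →
      (∀ᶠ y in 𝓝 x₀, Y y = φ y η) → ∀ᶠ y in 𝓝 x₀, A.bracket X Y y = φ y (br ξ η) := by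
    intro X Y ξ η hX hY
    filter_upwards [eventually_eventually_nhds.2 hX, eventually_eventually_nhds.2 hY,
      hU.mem_nhds hx₀] with y h1 h2 hy
    rw [← hbr ξ η y hy, A.localBracket_eq X Y h1 h2]
  have hadd : ∀ {X Y : Cₛ^∞⟮𝓘(ℝ, E); F, V⟯} {ξ η : H}, (∀ᶠ y in 𝓝 x₀, X y = φ y ξ) →
      (∀ᶠ y in 𝓝 x₀, Y y = φ y η) → ∀ᶠ y in 𝓝 x₀, (X + Y) y = φ y (ξ + η) := by
    intro X Y ξ η hX hY
    filter_upwards [hX, hY] with y h1 h2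
    rw [ContMDiffSection.coe_add, Pi.add_apply, h1, h2, map_add]
  have hinj : ∀ {X : Cₛ^∞⟮𝓘(ℝ, E); F, V⟯} {ξ η : H}, (∀ᶠ y in 𝓝 x₀, X y = φ y ξ) →
      (∀ᶠ y in 𝓝 x₀, X y = φ y η) → ξ = η := fun h1 h2 =>
    (hφ.bijective x₀ hx₀).1 (h1.self_of_nhds.symm.trans h2.self_of_nhds)
  let : LieRing H :=
    { toAddCommGroup := inferInstance
      bracket := br
      add_lie := fun ξ η ζ => by
        have h1 := hglob (hadd (hS ξ) (hS η)) (hS ζ)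
        rw [map_add, LinearMap.add_apply] at h1
        exact hinj h1 (hadd (hglob (hS ξ) (hS ζ)) (hglob (hS η) (hS ζ)))
      lie_add := fun ξ η ζ => by
        have h1 := hglob (hS ξ) (hadd (hS η) (hS ζ))
        rw [map_add] at h1
        exact hinj h1 (hadd (hglob (hS ξ) (hS η)) (hglob (hS ξ) (hS ζ)))
      lie_self := fun ξ => by
        have h1 := hglob (hS ξ) (hS ξ)
        rw [A.bracket_self] at h1
        exact hinj h1 (Filter.Eventually.of_forall fun y => by simp)
      leibniz_lie := fun ξ η ζ => by
        have h1 := hglob (hS ξ) (hglob (hS η) (hS ζ))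
        rw [A.jacobi] at h1
        exact hinj h1 (hadd (hglob (hglob (hS ξ) (hS η)) (hS ζ))
          (hglob (hS η) (hglob (hS ξ) (hS ζ)))) }
  let : LieAlgebra ℝ H :=
    { lie_smul := fun c ξ η => by
        have hsmul : ∀ {X : Cₛ^∞⟮𝓘(ℝ, E); F, V⟯} {ξ : H}, (∀ᶠ y in 𝓝 x₀, X y = φ y ξ) →
            ∀ᶠ y in 𝓝 x₀, (c • X) y = φ y (c • ξ) := by
          intro X ξ hX
          filter_upwards [hX] with y h1
          rw [ContMDiffSection.coe_smul, Pi.smul_apply, h1, map_smul]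
        have h1 := hglob (hS ξ) (hsmul (hS η))
        rw [map_smul] at h1
        exact hinj h1 (hsmul (hglob (hS ξ) (hS η))) }
  let ρ : LieAlgebraActionOn E H U :=
    { field :=
        { toFun := fun ξ x => A.anchor x (φ x ξ)
          map_add' := fun ξ η => by ext x; simp
          map_smul' := fun c ξ => by ext x; simp }
      smooth := fun ξ => ContMDiffOn.clm_bundle_apply A.anchor.contMDiff.contMDiffOn (hφ.smooth ξ)
      map_lie := fun ξ η x hx => by
        obtain ⟨X, hX⟩ := exists_contMDiffSection_eventuallyEq hU hx (hφ.smooth ξ)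
        obtain ⟨Y, hY⟩ := exists_contMDiffSection_eventuallyEq hU hx (hφ.smooth η)
        have h1 : φ x ⁅ξ, η⁆ = A.bracket X Y x := by
          rw [← A.localBracket_eq X Y hX hY, hbr ξ η x hx]
          rfl
        change A.anchor x (φ x ⁅ξ, η⁆) = _
        rw [h1, A.anchor_bracket]
        refine Filter.EventuallyEq.mlieBracket_vectorField_eq ?_ ?_
        · filter_upwards [hX] with y hy
          exact congrArg (A.anchor y) hy
        · filter_upwards [hY] with y hy
          exact congrArg (A.anchor y) hy }
  exact ⟨H, inferInstance, inferInstance, inferInstance, ρ, φ,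
    isActionIsoOn_of_parallel hU hφ.smooth hφ.bijective hφ.parallel (fun x _ ξ => rfl) hbr⟩

section Global

/-- A parallel section of a connected bundle, with local parallel frames, is determined by its
value at any point. -/
theorem eq_zero_of_parallel [PreconnectedSpace M] {H : Type*} [NormedAddCommGroup H]
    [NormedSpace ℝ H] [FiniteDimensional ℝ H]
    (h : ∀ x : M, ∃ U : Set M, IsOpen U ∧ x ∈ U ∧
      ∃ φ : Π x : M, H →ₗ[ℝ] V x, IsParallelFrameOn A.conn φ U)
    {X : Cₛ^∞⟮𝓘(ℝ, E); F, V⟯} (hX : X ∈ A.parallelSections) {x₀ : M} (hx₀ : X x₀ = 0) :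
    X = 0 := by
  ext y
  refine PreconnectedSpace.induction₂' (fun x y => X x = 0 → X y = 0) (fun x => ?_)
    ⟨fun _ _ _ h1 h2 h3 => h2 (h1 h3)⟩ x₀ y hx₀
  obtain ⟨U, hU, hxU, φ, hφ⟩ := h x
  obtain ⟨ξ, hξ⟩ := (hφ.bijective x hxU).2 (X x)
  filter_upwards [hφ.eventually_eq_of_parallel (hU.mem_nhds hxU) X.contMDiff.contMDiffAt
    (Filter.Eventually.of_forall (conn_eq_zero_of_mem hX)) hξ.symm, hU.mem_nhds hxU] with y hy hyU
  -- Near `x`, vanishing of `X` depends only on `ξ` and not on the point, so it propagates through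
  -- the connected manifold.
  have h1 : X x = 0 ↔ ξ = 0 := by
    rw [← hξ]; exact map_eq_zero_iff _ (hφ.bijective x hxU).1
  have h2 : X y = 0 ↔ ξ = 0 := by
    rw [hy]; exact map_eq_zero_iff _ (hφ.bijective y hyU).1
  rw [h1, h2]
  exact ⟨id, id⟩

/-- If every vector extends to a global parallel section, then the Cartan algebroid is globally
symmetric. -/
theorem isSymmetric_of_surjective [ConnectedSpace M]
    (h : ∀ x : M, ∃ U : Set M, IsOpen U ∧ x ∈ U ∧
      ∃ φ : Π x : M, F →ₗ[ℝ] V x, IsParallelFrameOn A.conn φ U)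
    (hsurj : ∀ x : M, Function.Surjective (A.parallelEval x)) :
    A.IsSymmetric ∧ ∃ _ : Module.Finite ℝ A.parallelSections,
      A.IsActionIsoOn A.parallelAction A.parallelEval := by
  have hinj : ∀ x : M, Function.Injective (A.parallelEval x) := by
    intro x
    rw [← LinearMap.ker_eq_bot, LinearMap.ker_eq_bot']
    intro X hX
    exact Subtype.ext (eq_zero_of_parallel h X.2 hX)
  obtain ⟨x₀⟩ : Nonempty M := inferInstance
  let e := (trivializationAt F V x₀).linearEquivAt ℝ x₀
    (FiberBundle.mem_baseSet_trivializationAt' x₀)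
  -- Evaluation at a single point embeds the parallel sections into the model fibre.
  have hfin : Module.Finite ℝ A.parallelSections :=
    Module.Finite.of_injective (e.toLinearMap ∘ₗ A.parallelEval x₀) (e.injective.comp (hinj x₀))
  refine ⟨?_, hfin, isActionIsoOn_of_parallel isOpen_univ (fun X => X.1.contMDiff.contMDiffOn)
    (fun x _ => ⟨hinj x, hsurj x⟩) (fun X x _ => conn_eq_zero_of_mem X.2 x) (fun x _ X => rfl)
    (fun X Y x _ => A.localBracket_eq X.1 Y.1 (Filter.Eventually.of_forall fun _ => rfl)
      (Filter.Eventually.of_forall fun _ => rfl))⟩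
  -- Symmetry asks for a Lie algebra in `Type`, so coordinates replace the space of parallel
  -- sections.
  let N := (Module.finBasis ℝ A.parallelSections).equivFun.symm
  refine isSymmetricOn_of_isParallelFrameOn (φ := fun x => A.parallelEval x ∘ₗ N.toLinearMap)
    ⟨fun ξ => (N ξ).1.contMDiff.contMDiffOn, fun x _ => ?_, fun ξ x _ => ?_⟩ isOpen_univ
    isPreconnected_univ (Set.mem_univ x₀)
  · exact (show Function.Bijective (A.parallelEval x) from ⟨hinj x, hsurj x⟩).comp N.bijective
  · exact conn_eq_zero_of_mem (N ξ).2 x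

end Global

end CartanAlgebroid

end Symmetric

/-! ### Monodromy: global sections over a simply connected base -/

/-- Over a simply connected space, a locally constant cocycle has a global locally constant section
through every point. -/
theorem exists_locallyConstant_section {B : Type*} [TopologicalSpace B] [SimplyConnectedSpace B]
    [LocallyPathConnectedSpace B] {D : Type*} (U : B → Set B) (hU : ∀ i, IsOpen (U i))
    (hmem : ∀ x, x ∈ U x) (t : B → B → B → D → D) (t_self : ∀ i, ∀ x ∈ U i, ∀ d, t i i x d = d)
    (t_loc : ∀ i j, ∀ x ∈ U i ∩ U j, ∀ d, ∀ᶠ y in 𝓝 x, t i j y d = t i j x d)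
    (t_comp : ∀ i j k, ∀ x ∈ U i ∩ U j ∩ U k, ∀ d, t j k x (t i j x d) = t i k x d)
    (x₀ : B) (d₀ : D) :
    ∃ σ : B → D, σ x₀ = d₀ ∧ ∀ x, ∀ᶠ y in 𝓝 x, t y x y (σ y) = σ x := by
  let : TopologicalSpace D := ⊥
  have : DiscreteTopology D := ⟨rfl⟩
  -- With discrete fibre `D` the cocycle glues to a covering of `B`, and simple connectedness lifts
  -- the identity map to a section. The preferred chart at `y` is `U y`, so `σ y` is the coordinate
  -- there and `t y x y (σ y)` the coordinate in the chart of `x`.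
  let Z : FiberBundleCore B B D :=
    { baseSet := U
      isOpen_baseSet := hU
      indexAt := id
      mem_baseSet_at := hmem
      coordChange := t
      coordChange_self := t_self
      continuousOn_coordChange := fun i j => by
        rintro ⟨x, d⟩ ⟨hx, -⟩
        refine ContinuousAt.continuousWithinAt ?_
        have h1 : ∀ᶠ p : B × D in 𝓝 (x, d), t i j p.1 p.2 = t i j x d := by
          rw [nhds_prod_eq, nhds_discrete D, Filter.prod_pure, Filter.eventually_map]
          exact t_loc i j x hx d
        exact (continuousAt_const (y := t i j x d)).congr (h1.mono fun _ h => h.symm)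
      coordChange_comp := t_comp }
  have hcov : IsCoveringMap (Bundle.TotalSpace.proj : Z.TotalSpace → B) :=
    FiberBundle.isCoveringMap (F := D) (E := Z.Fiber)
  obtain ⟨s, ⟨hs₀, hs⟩, -⟩ := hcov.existsUnique_continuousMap_lifts (ContinuousMap.id B) x₀
    (⟨x₀, d₀⟩ : Z.TotalSpace) rfl
  have hproj : ∀ x, (s x).proj = x := fun x => congrFun hs x
  let snd : Z.TotalSpace → D := fun p => p.snd
  refine ⟨fun x => snd (s x), congrArg snd hs₀, fun x => ?_⟩
  have hx : (s x).proj ∈ (Z.localTriv x).baseSet := by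
    rw [hproj]; exact hmem x
  have hcont : ContinuousAt (fun y => (Z.localTriv x (s y)).2) x :=
    continuousAt_snd.comp (((Z.localTriv x).continuousAt
      ((Z.localTriv x).mem_source.2 hx)).comp s.continuous.continuousAt)
  have hev : ∀ᶠ y in 𝓝 x, (Z.localTriv x (s y)).2 = (Z.localTriv x (s x)).2 :=
    hcont.eventually_mem ((isOpen_discrete {(Z.localTriv x (s x)).2}).mem_nhds rfl)
  filter_upwards [hev] with y hy
  have h1 : ∀ y, (Z.localTriv x (s y)).2 = t y x y (snd (s y)) := fun y => by
    change t (s y).proj x (s y).proj (snd (s y)) = _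
    rw [hproj]
  rw [h1, h1, t_self x x (hmem x)] at hy
  exact hy

section SimplyConnected

variable {E : Type*} [NormedAddCommGroup E] [NormedSpace ℝ E] [FiniteDimensional ℝ E]
  {M : Type*} [TopologicalSpace M] [T2Space M] [ChartedSpace E M] [IsManifold 𝓘(ℝ, E) ∞ M]
  {F : Type*} [NormedAddCommGroup F] [NormedSpace ℝ F] [FiniteDimensional ℝ F]
  {V : M → Type*} [TopologicalSpace (TotalSpace F V)] [∀ x, TopologicalSpace (V x)]
  [FiberBundle F V] [∀ x, AddCommGroup (V x)] [∀ x, Module ℝ (V x)] [VectorBundle ℝ F V]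
  [ContMDiffVectorBundle ∞ F V 𝓘(ℝ, E)]
  [∀ x, IsTopologicalAddGroup (V x)] [∀ x, ContinuousSMul ℝ (V x)]

/-- On a simply connected manifold, local parallel frames can be continued to global parallel
sections. -/
theorem CartanAlgebroid.parallelEval_surjective {A : CartanAlgebroid E F V}
    [SimplyConnectedSpace M]
    (h : ∀ x : M, ∃ U : Set M, IsOpen U ∧ x ∈ U ∧
      ∃ φ : Π x : M, F →ₗ[ℝ] V x, IsParallelFrameOn A.conn φ U) (x₀ : M) :
    Function.Surjective (A.parallelEval x₀) := by
  have : LocallyPathConnectedSpace M := ChartedSpace.locallyPathConnectedSpace E M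
  intro v
  choose U hU hmem φ hφ using h
  have hinv : ∀ j, ∀ y ∈ U j, ∀ w, φ j y (Function.invFun (φ j y) w) = w := fun j y hy w =>
    Function.invFun_eq (((hφ j).bijective y hy).2 w)
  have hinv' : ∀ j, ∀ y ∈ U j, ∀ d, Function.invFun (φ j y) (φ j y d) = d := fun j y hy d =>
    ((hφ j).bijective y hy).1 (hinv j y hy _)
  -- The cocycle consists of the frame changes `φ j⁻¹ ∘ φ i`, locally constant because a section
  -- parallel in one frame has locally constant components in another.
  obtain ⟨σ, hσ₀, hσ⟩ := exists_locallyConstant_section U hU hmem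
    (fun i j y d => Function.invFun (φ j y) (φ i y d)) (fun i x hx d => hinv' i x hx d)
    (fun i j x hx d => by
      have hi := (hU i).mem_nhds hx.1
      have hj := (hU j).mem_nhds hx.2
      filter_upwards [(hφ j).eventually_eq_of_parallel hj ((hφ i).contMDiffAt hi d)
        (Filter.mem_of_superset hi fun y hy => (hφ i).parallel d y hy)
        (hinv j x hx.2 (φ i x d)).symm, hj] with y hy hyj
      rw [hy, hinv' j y hyj])
    (fun i j k x hx d => by simp only [hinv j x hx.1.2])
    x₀ (Function.invFun (φ x₀ x₀) v)
  have hloc : ∀ x, ∀ᶠ y in 𝓝 x, φ y y (σ y) = φ x y (σ x) := by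
    intro x
    filter_upwards [hσ x, (hU x).mem_nhds (hmem x)] with y hy hyU
    rw [← hy, hinv x y hyU]
  let X : Cₛ^∞⟮𝓘(ℝ, E); F, V⟯ := ⟨fun y => φ y y (σ y), fun x => by
    refine ((hφ x).contMDiffAt ((hU x).mem_nhds (hmem x)) (σ x)).congr_of_eventuallyEq ?_
    filter_upwards [hloc x] with y hy
    rw [hy]⟩
  refine ⟨⟨X, CartanAlgebroid.mem_parallelSections fun x => ?_⟩, ?_⟩
  · exact (A.conn.congr_germ X.mdifferentiableAt (hloc x)).trans
      ((hφ x).parallel (σ x) x (hmem x))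
  · change φ x₀ x₀ (σ x₀) = v
    rw [hσ₀, hinv x₀ x₀ (hmem x₀)]

end SimplyConnected

theorem HasFDerivAt.clm_apply_apply_const {E F G H : Type*} [NormedAddCommGroup E]
    [NormedSpace ℝ E] [NormedAddCommGroup F] [NormedSpace ℝ F] [NormedAddCommGroup G]
    [NormedSpace ℝ G] [NormedAddCommGroup H] [NormedSpace ℝ H] {Γ : E → F →L[ℝ] G →L[ℝ] H}
    {Γ' : E →L[ℝ] F →L[ℝ] G →L[ℝ] H} {z : E} (h : HasFDerivAt Γ Γ' z) (w : F) (ξ : G) :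
    HasFDerivAt (fun z => Γ z w ξ) ((Γ'.flip w).flip ξ) z := by
  convert (h.clm_apply (hasFDerivAt_const w z)).clm_apply (hasFDerivAt_const ξ z) using 1
  ext v
  simp

/-! ### Coordinate vector fields of a chart -/

section CoordinateFields

variable {E : Type*} [NormedAddCommGroup E] [NormedSpace ℝ E] [FiniteDimensional ℝ E]
  {M : Type*} [TopologicalSpace M] [ChartedSpace E M] [IsManifold 𝓘(ℝ, E) ∞ M]

/-- The constant vector field with value `w` on a normed space. -/
def constField (w : E) : Π z : E, TangentSpace 𝓘(ℝ, E) z :=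
  fun _ => w

/-- The coordinate vector field, in the chart at `x₀`, with constant value `w`. -/
noncomputable def chartField (x₀ : M) (w : E) : Π y : M, TangentSpace 𝓘(ℝ, E) y :=
  mpullback 𝓘(ℝ, E) 𝓘(ℝ, E) (chartAt E x₀) (constField w)

theorem isInvertible_mfderiv_chartAt {x₀ y : M} (hy : y ∈ (chartAt E x₀).source) :
    (mfderiv 𝓘(ℝ, E) 𝓘(ℝ, E) (chartAt E x₀) y).IsInvertible := by
  have : IsManifold 𝓘(ℝ, E) 1 M := IsManifold.of_le (n := ∞) (by exact_mod_cast le_top)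
  exact ⟨(mdifferentiable_chart (I := 𝓘(ℝ, E)) x₀).mfderiv hy, rfl⟩

theorem mfderiv_chartField {x₀ y : M} (hy : y ∈ (chartAt E x₀).source) (w : E) :
    mfderiv 𝓘(ℝ, E) 𝓘(ℝ, E) (chartAt E x₀) y (chartField x₀ w y) = w := by
  obtain ⟨N, hN⟩ := isInvertible_mfderiv_chartAt hy
  have h : chartField x₀ w y = N.symm w := by
    have : (mfderiv 𝓘(ℝ, E) 𝓘(ℝ, E) (chartAt E x₀) y).inverse = N.symm := by
      rw [← hN, ContinuousLinearMap.inverse_equiv]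
    exact DFunLike.congr_fun this w
  rw [h, ← hN]
  exact N.apply_symm_apply w

theorem chartField_mfderiv {x₀ y : M} (hy : y ∈ (chartAt E x₀).source)
    (u : TangentSpace 𝓘(ℝ, E) y) :
    chartField (E := E) x₀ (mfderiv 𝓘(ℝ, E) 𝓘(ℝ, E) (chartAt E x₀) y u) y = u := by
  obtain ⟨N, hN⟩ := isInvertible_mfderiv_chartAt hy
  apply N.injective
  have h := mfderiv_chartField hy (mfderiv 𝓘(ℝ, E) 𝓘(ℝ, E) (chartAt E x₀) y u)
  rw [← hN] at h ⊢
  exact h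

theorem contMDiff_constField (w : E) :
    ContMDiff 𝓘(ℝ, E) 𝓘(ℝ, E).tangent ∞ (fun z : E => (⟨z, constField w z⟩ : TangentBundle 𝓘(ℝ, E) E)) :=
  contMDiff_vectorSpace_iff_contDiff.2 contDiff_const

theorem contMDiffOn_chartField (x₀ : M) (w : E) :
    ContMDiffOn 𝓘(ℝ, E) 𝓘(ℝ, E).tangent ∞
      (fun y => (⟨y, chartField x₀ w y⟩ : TangentBundle 𝓘(ℝ, E) M)) (chartAt E x₀).source := by
  intro y hy
  have h1 : ContMDiffAt 𝓘(ℝ, E) 𝓘(ℝ, E) ∞ (chartAt E x₀) y :=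
    contMDiffOn_chart.contMDiffAt ((chartAt E x₀).open_source.mem_nhds hy)
  exact (ContMDiffAt.mpullback_vectorField_preimage (contMDiff_constField w _) h1
    (isInvertible_mfderiv_chartAt hy) (by simp)).contMDiffWithinAt

/-- Pullback by the chart commutes with Lie brackets, and constant fields commute. This removes the
bracket term from the curvature in coordinates. -/
theorem mlieBracket_chartField {x₀ y : M} (hy : y ∈ (chartAt E x₀).source) (v w : E) :
    mlieBracket 𝓘(ℝ, E) (chartField x₀ v) (chartField x₀ w) y = 0 := by
  have h1 : ContMDiffAt 𝓘(ℝ, E) 𝓘(ℝ, E) ∞ (chartAt E x₀) y :=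
    contMDiffOn_chart.contMDiffAt ((chartAt E x₀).open_source.mem_nhds hy)
  have : IsManifold 𝓘(ℝ, E) (minSmoothness ℝ 2) M := by
    rw [minSmoothness_of_isRCLikeNormedField]; infer_instance
  have h2 := mpullback_mlieBracket (I := 𝓘(ℝ, E)) (I' := 𝓘(ℝ, E)) (x₀ := y)
    ((contMDiff_constField v).mdifferentiable (by simp) _)
    ((contMDiff_constField w).mdifferentiable (by simp) _) h1
    (by rw [minSmoothness_of_isRCLikeNormedField]; decide)
  refine h2.symm.trans ?_
  have h3 : mlieBracket 𝓘(ℝ, E) (constField v) (constField w) = 0 := by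
    rw [← mlieBracketWithin_univ, mlieBracketWithin_eq_lieBracketWithin]
    ext z
    change fderivWithin ℝ (fun _ : E => w) Set.univ z v -
      fderivWithin ℝ (fun _ : E => v) Set.univ z w = 0
    simp
  exact (congrArg (fun X => mpullback 𝓘(ℝ, E) 𝓘(ℝ, E) (chartAt E x₀) X y) h3).trans
    (by simp)

end CoordinateFields

/-! ### The frame of a local trivialization -/

section Trivialization

variable {E : Type*} [NormedAddCommGroup E] [NormedSpace ℝ E]
  {M : Type*} [TopologicalSpace M] [ChartedSpace E M] [IsManifold 𝓘(ℝ, E) ∞ M]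
  {F : Type*} [NormedAddCommGroup F] [NormedSpace ℝ F]
  {V : M → Type*} [TopologicalSpace (TotalSpace F V)] [∀ x, TopologicalSpace (V x)]
  [FiberBundle F V] [∀ x, AddCommGroup (V x)] [∀ x, Module ℝ (V x)] [VectorBundle ℝ F V]
  [ContMDiffVectorBundle ∞ F V 𝓘(ℝ, E)]

theorem Bundle.Trivialization.contMDiffOn_symmₗ (e : Trivialization F (π F V))
    [MemTrivializationAtlas e] (ξ : F) :
    ContMDiffOn 𝓘(ℝ, E) (𝓘(ℝ, E).prod 𝓘(ℝ, F)) ∞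
      (fun y => (⟨y, e.symmₗ ℝ y ξ⟩ : TotalSpace F V)) e.baseSet := by
  rw [e.contMDiffOn_section_baseSet_iff]
  refine (contMDiffOn_const (c := ξ)).congr fun y hy => ?_
  rw [e.symmₗ_apply hy]
  exact congrArg Prod.snd (e.apply_mk_symm hy ξ)

theorem Bundle.Trivialization.bijective_symmₗ (e : Trivialization F (π F V))
    [MemTrivializationAtlas e] {y : M} (hy : y ∈ e.baseSet) :
    Function.Bijective (e.symmₗ ℝ y) := by
  rw [e.coe_symmₗ hy]
  exact (e.linearEquivAt ℝ y hy).symm.bijective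

end Trivialization

/-! ### Connection forms and parallel frames of flat connections -/

section ConnectionForm

variable {E : Type*} [NormedAddCommGroup E] [NormedSpace ℝ E] [FiniteDimensional ℝ E]
  {M : Type*} [TopologicalSpace M] [T2Space M] [ChartedSpace E M] [IsManifold 𝓘(ℝ, E) ∞ M]
  {F : Type*} [NormedAddCommGroup F] [NormedSpace ℝ F] [FiniteDimensional ℝ F]
  {V : M → Type*} [TopologicalSpace (TotalSpace F V)] [∀ x, TopologicalSpace (V x)]
  [FiberBundle F V] [∀ x, AddCommGroup (V x)] [∀ x, Module ℝ (V x)] [VectorBundle ℝ F V]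
  [ContMDiffVectorBundle ∞ F V 𝓘(ℝ, E)]
  [∀ x, IsTopologicalAddGroup (V x)] [∀ x, ContinuousSMul ℝ (V x)]

namespace CartanAlgebroid

variable {A : CartanAlgebroid E F V}

/-- The connection form in a local trivialization and a chart. -/
theorem exists_connectionForm (A : CartanAlgebroid E F V) (x₀ : M)
    (e : Trivialization F (π F V)) [MemTrivializationAtlas e] :
    ∃ Γ : E → E →L[ℝ] F →L[ℝ] F,
      ContDiffOn ℝ ∞ Γ ((chartAt E x₀).target ∩ (chartAt E x₀).symm ⁻¹' e.baseSet) ∧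
      ∀ y ∈ (chartAt E x₀).source ∩ e.baseSet, ∀ w η,
        A.conn (fun y' => e.symmₗ ℝ y' η) y (chartField x₀ w y) =
          e.symmₗ ℝ y (Γ (chartAt E x₀ y) w η) := by
  set χ := chartAt E x₀ with hχ
  let b := Module.finBasis ℝ F
  -- The derivative of the `i`th trivializing section, read in coordinates. Composing with the
  -- inverse chart derivative feeds it chart fields.
  let B : Fin (Module.finrank ℝ F) → E → E →L[ℝ] F := fun i z =>
    (e.continuousLinearMapAt ℝ (χ.symm z)).comp
      ((A.conn (fun y' => e.symmₗ ℝ y' (b i)) (χ.symm z)).comp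
        (mfderiv 𝓘(ℝ, E) 𝓘(ℝ, E) χ (χ.symm z)).inverse)
  have hB : ∀ i z w, B i z w = e.continuousLinearMapAt ℝ (χ.symm z)
      (A.conn (fun y' => e.symmₗ ℝ y' (b i)) (χ.symm z) (chartField x₀ w (χ.symm z))) :=
    fun _ _ _ => rfl
  have hopen : IsOpen (χ.target ∩ χ.symm ⁻¹' e.baseSet) :=
    χ.symm.isOpen_inter_preimage e.open_baseSet
  refine ⟨fun z => ∑ i, (ContinuousLinearMap.smulRightL ℝ F F
    (LinearMap.toContinuousLinearMap (b.coord i))).comp (B i z), ?_, ?_⟩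
  · refine ContDiffOn.sum fun i _ => contDiffOn_const.clm_comp ?_
    refine contDiffOn_clm_apply.2 fun w z hz => ?_
    -- Smoothness is checked for each fixed `w`. Near the point, the local section and chart field
    -- are replaced by global `S` and `Z`, for which `∇_Z S` is a smooth section.
    have hzs : χ.symm z ∈ χ.source := χ.map_target hz.1
    obtain ⟨S, hS⟩ := exists_contMDiffSection_eventuallyEq e.open_baseSet hz.2
      (e.contMDiffOn_symmₗ (E := E) (b i))
    obtain ⟨Z, hZ⟩ := exists_contMDiffSection_eventuallyEq (V := TangentSpace 𝓘(ℝ, E))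
      χ.open_source hzs (contMDiffOn_chartField x₀ w)
    have h1 : ContMDiffAt 𝓘(ℝ, E) 𝓘(ℝ, F) ∞ (fun y => (e ⟨y, A.nabla Z S y⟩).2) (χ.symm z) :=
      (e.contMDiffAt_section_iff hz.2).1 (A.nabla Z S).contMDiff.contMDiffAt
    have h2 : ContMDiffAt 𝓘(ℝ, E) 𝓘(ℝ, E) ∞ χ.symm z :=
      contMDiffOn_chart_symm.contMDiffAt (χ.open_target.mem_nhds hz.1)
    have h3 := (h1.comp z h2).contDiffAt
    refine (h3.congr_of_eventuallyEq ?_).contDiffWithinAt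
    filter_upwards [hopen.mem_nhds hz,
      (χ.symm.continuousAt hz.1).eventually (eventually_eventually_nhds.2 hS),
      (χ.symm.continuousAt hz.1).eventually hZ] with z' hz' hS' hZ'
    rw [hB, Function.comp_apply, e.continuousLinearMapAt_apply_of_mem ℝ hz'.2]
    change _ = (e ⟨χ.symm z', A.conn S (χ.symm z') (Z (χ.symm z'))⟩).2
    rw [hZ', A.conn.congr_germ S.mdifferentiableAt hS']
  · rintro y ⟨hys, hye⟩ w η
    have hd : ∀ ξ, MDifferentiableAt 𝓘(ℝ, E) (𝓘(ℝ, E).prod 𝓘(ℝ, F))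
        (fun y' => (⟨y', e.symmₗ ℝ y' ξ⟩ : TotalSpace F V)) y := fun ξ =>
      ((e.contMDiffOn_symmₗ ξ).contMDiffAt (e.open_baseSet.mem_nhds hye)).mdifferentiableAt
        (by simp)
    have h1 : A.conn (fun y' => e.symmₗ ℝ y' η) y (chartField x₀ w y) =
        ∑ i, b.coord i η • A.conn (fun y' => e.symmₗ ℝ y' (b i)) y (chartField x₀ w y) := by
      simp_rw [fun y' => linearMap_apply_eq_sum (e.symmₗ ℝ y') η]
      rw [A.conn.sum_smul Finset.univ (fun i _ => b.coord i η) _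
        (fun i => mdifferentiableAt_const) (fun i => hd _)]
      simp [mvfderiv_const, b]
    rw [h1]
    simp only [sum_apply, map_sum]
    refine Finset.sum_congr rfl fun i _ => ?_
    have h2 : ∀ y', y' = y → e.symmₗ ℝ y (e.continuousLinearMapAt ℝ y'
        (A.conn (fun y' => e.symmₗ ℝ y' (b i)) y' (chartField x₀ w y'))) =
        A.conn (fun y' => e.symmₗ ℝ y' (b i)) y (chartField x₀ w y) := by
      rintro _ rfl
      exact e.symmL_continuousLinearMapAt hye _
    simp only [ContinuousLinearMap.comp_apply, ContinuousLinearMap.smulRightL_apply_apply, hB,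
      map_smul, ContinuousLinearMap.smulRight_apply, LinearMap.coe_toContinuousLinearMap',
      h2 _ (χ.left_inv hys)]

set_option synthInstance.maxHeartbeats 200000 in
/-- The structure equation `dΓ + Γ ∧ Γ = 0` for the connection form of a flat connection. -/
theorem IsFlat.structure_equation (hA : A.IsFlat) {x₀ : M}
    {e : Trivialization F (π F V)} [MemTrivializationAtlas e] {Γ : E → E →L[ℝ] F →L[ℝ] F}
    (hΓ : ContDiffOn ℝ ∞ Γ ((chartAt E x₀).target ∩ (chartAt E x₀).symm ⁻¹' e.baseSet))
    (hΓ' : ∀ y ∈ (chartAt E x₀).source ∩ e.baseSet, ∀ w η,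
        A.conn (fun y' => e.symmₗ ℝ y' η) y (chartField x₀ w y) =
          e.symmₗ ℝ y (Γ (chartAt E x₀ y) w η))
    {y : M} (hys : y ∈ (chartAt E x₀).source) (hye : y ∈ e.baseSet) (v w : E) :
    fderiv ℝ Γ (chartAt E x₀ y) v w - fderiv ℝ Γ (chartAt E x₀ y) w v +
      (Γ (chartAt E x₀ y) v * Γ (chartAt E x₀ y) w
        - Γ (chartAt E x₀ y) w * Γ (chartAt E x₀ y) v) = 0 := by
  set χ := chartAt E x₀ with hχ
  have hopen : IsOpen (χ.target ∩ χ.symm ⁻¹' e.baseSet) :=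
    χ.symm.isOpen_inter_preimage e.open_baseSet
  have hNn : ∀ᶠ y' in 𝓝 y, y' ∈ χ.source ∩ e.baseSet :=
    (χ.open_source.inter e.open_baseSet).mem_nhds ⟨hys, hye⟩
  have hz : χ y ∈ χ.target ∩ χ.symm ⁻¹' e.baseSet :=
    ⟨χ.map_source hys, by simpa [χ.left_inv hys] using hye⟩
  have hd : ∀ ξ, MDifferentiableAt 𝓘(ℝ, E) (𝓘(ℝ, E).prod 𝓘(ℝ, F))
      (fun y' => (⟨y', e.symmₗ ℝ y' ξ⟩ : TotalSpace F V)) y := fun ξ =>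
    ((e.contMDiffOn_symmₗ ξ).contMDiffAt (e.open_baseSet.mem_nhds hye)).mdifferentiableAt
      (by simp)
  have hΓd : DifferentiableAt ℝ Γ (χ y) :=
    (hΓ.contDiffAt (hopen.mem_nhds hz)).differentiableAt (by simp)
  have hχd : MDifferentiableAt 𝓘(ℝ, E) 𝓘(ℝ, E) χ y :=
    (contMDiffOn_chart.contMDiffAt (n := ∞) (χ.open_source.mem_nhds hys)).mdifferentiableAt
      (by simp)
  ext ξ
  obtain ⟨S, hS⟩ := exists_contMDiffSection_eventuallyEq e.open_baseSet hye
    (e.contMDiffOn_symmₗ (E := E) ξ)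
  choose Z hZ using fun w : E => exists_contMDiffSection_eventuallyEq (V := TangentSpace 𝓘(ℝ, E))
    χ.open_source hys (contMDiffOn_chartField x₀ w)
  have h1 : ∀ w, ∀ᶠ y' in 𝓝 y, A.nabla (Z w) S y' = e.symmₗ ℝ y' (Γ (χ y') w ξ) := by
    intro w
    filter_upwards [hNn, eventually_eventually_nhds.2 hS, hZ w] with y' hy' hS' hZ'
    change A.conn S y' (Z w y') = _
    rw [hZ', A.conn.congr_germ S.mdifferentiableAt hS', hΓ' y' hy']
  -- Differentiating `Γ w ξ` gives the `dΓ` term, and differentiating the frame gives the quadratic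
  -- term. Antisymmetrizing in `v` and `w` yields the curvature.
  have h2 : ∀ v w, A.nabla (Z v) (A.nabla (Z w) S) y =
      e.symmₗ ℝ y (fderiv ℝ Γ (χ y) v w ξ + Γ (χ y) v (Γ (χ y) w ξ)) := by
    intro v w
    have hg : HasMFDerivAt 𝓘(ℝ, E) 𝓘(ℝ, F) (fun y' => Γ (χ y') w ξ) y
        ((((fderiv ℝ Γ (χ y)).flip w).flip ξ).comp (mfderiv 𝓘(ℝ, E) 𝓘(ℝ, E) χ y)) := by
      have h3 : HasFDerivAt (fun z => Γ z w ξ) (((fderiv ℝ Γ (χ y)).flip w).flip ξ) (χ y) :=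
        hΓd.hasFDerivAt.clm_apply_apply_const w ξ
      exact h3.hasMFDerivAt.comp y hχd.hasMFDerivAt
    change A.conn (A.nabla (Z w) S) y (Z v y) = _
    rw [A.conn.congr_germ (A.nabla (Z w) S).mdifferentiableAt (h1 w),
      A.conn.frame_apply hd hg.mdifferentiableAt, (hZ v).self_of_nhds, hΓ' y ⟨hys, hye⟩,
      ← map_add]
    congr 2
    have h4 : mvfderiv 𝓘(ℝ, E) (fun y' => Γ (χ y') w ξ) y (chartField x₀ v y) =
        fderiv ℝ Γ (χ y) (mfderiv 𝓘(ℝ, E) 𝓘(ℝ, E) χ y (chartField x₀ v y)) w ξ :=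
      DFunLike.congr_fun hg.mfderiv _
    rw [h4, mfderiv_chartField hys]
  have h5 : (SmoothVectorField.lie (Z v) (Z w)) y = 0 :=
    (Filter.EventuallyEq.mlieBracket_vectorField_eq (hZ v) (hZ w)).trans
      (mlieBracket_chartField hys v w)
  have h6 : A.nabla (SmoothVectorField.lie (Z v) (Z w)) S y = 0 := by
    change A.conn S y (SmoothVectorField.lie (Z v) (Z w) y) = 0
    rw [h5, map_zero]
  have h7 := DFunLike.congr_fun (hA (Z v) (Z w) S) y
  simp only [ContMDiffSection.coe_sub, Pi.sub_apply, h6, h2, ContMDiffSection.coe_zero,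
    Pi.zero_apply, sub_zero, ← map_sub] at h7
  have h8 := (e.bijective_symmₗ hye).1 (h7.trans (map_zero _).symm)
  simp only [add_apply, sub_apply, mul_apply_eq_comp, zero_apply]
  rw [← h8]
  abel

/-- A flat connection admits parallel frames locally. -/
theorem IsFlat.exists_isParallelFrameOn (hA : A.IsFlat) (x : M) :
    ∃ U : Set M, IsOpen U ∧ x ∈ U ∧ ∃ φ : Π x, F →ₗ[ℝ] V x, IsParallelFrameOn A.conn φ U := by
  set χ := chartAt E x with hχ
  set e := trivializationAt F V x with he
  have hx : x ∈ χ.source := mem_chart_source E x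
  have hxe : x ∈ e.baseSet := FiberBundle.mem_baseSet_trivializationAt' x
  have hopen : IsOpen (χ.target ∩ χ.symm ⁻¹' e.baseSet) :=
    χ.symm.isOpen_inter_preimage e.open_baseSet
  obtain ⟨Γ, hΓ, hΓ'⟩ := A.exists_connectionForm x e
  obtain ⟨P, r, hr, hball, hP, hP'⟩ := exists_flat_gauge
    (hopen.mem_nhds ⟨χ.map_source hx, by simpa [χ.left_inv hx] using hxe⟩) hΓ
    fun z hz v w => by
      have := hA.structure_equation hΓ hΓ' (χ.map_target hz.1) hz.2 v w
      rwa [χ.right_inv hz.1] at this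
  have hU : IsOpen (χ.source ∩ χ ⁻¹' Metric.ball (χ x) r) :=
    χ.isOpen_inter_preimage Metric.isOpen_ball
  have hUe : ∀ y ∈ χ.source ∩ χ ⁻¹' Metric.ball (χ x) r, y ∈ e.baseSet := fun y hy => by
    simpa [χ.left_inv hy.1] using (hball hy.2).2
  have hPd : ∀ y ∈ χ.source ∩ χ ⁻¹' Metric.ball (χ x) r, ∀ ξ,
      ContMDiffAt 𝓘(ℝ, E) 𝓘(ℝ, F) ∞ (fun y' => P (χ y') ξ) y := fun y hy ξ => by
    have h1 : ContDiffAt ℝ ∞ (fun z => P z ξ) (χ y) :=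
      (hP.contDiffAt (Metric.isOpen_ball.mem_nhds hy.2)).clm_apply contDiffAt_const
    exact h1.contMDiffAt.comp y (contMDiffOn_chart.contMDiffAt (χ.open_source.mem_nhds hy.1))
  have hed : ∀ y ∈ χ.source ∩ χ ⁻¹' Metric.ball (χ x) r, ∀ ξ,
      ContMDiffAt 𝓘(ℝ, E) (𝓘(ℝ, E).prod 𝓘(ℝ, F)) ∞
        (fun y' => (⟨y', e.symmₗ ℝ y' ξ⟩ : TotalSpace F V)) y := fun y hy ξ =>
    (e.contMDiffOn_symmₗ ξ).contMDiffAt (e.open_baseSet.mem_nhds (hUe y hy))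
  -- Correct the trivializing frame by the gauge `P`. Its covariant derivative is the frame applied
  -- to `dP + ΓP`, which is zero, and `P` is pointwise invertible.
  refine ⟨_, hU, ⟨hx, Metric.mem_ball_self hr⟩, fun y => e.symmₗ ℝ y ∘ₗ (P (χ y)).toLinearMap,
    fun ξ y hy => ?_, fun y hy => ?_, fun ξ y hy => ?_⟩
  · exact (ContMDiffAt.frame_apply (hed y hy) (hPd y hy ξ)).contMDiffWithinAt
  · exact (e.bijective_symmₗ (hUe y hy)).comp
      (ContinuousLinearMap.isUnit_iff_bijective.1 (hP' _ hy.2).1)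
  · ext u
    have hχd : MDifferentiableAt 𝓘(ℝ, E) 𝓘(ℝ, E) χ y :=
      (contMDiffOn_chart.contMDiffAt (n := ∞) (χ.open_source.mem_nhds hy.1)).mdifferentiableAt
        (by simp)
    have hPy : DifferentiableAt ℝ P (χ y) :=
      (hP.contDiffAt (Metric.isOpen_ball.mem_nhds hy.2)).differentiableAt (by simp)
    have h1 : HasMFDerivAt 𝓘(ℝ, E) 𝓘(ℝ, F) (fun y' => P (χ y') ξ) y
        (((fderiv ℝ P (χ y)).flip ξ).comp (mfderiv 𝓘(ℝ, E) 𝓘(ℝ, E) χ y)) := by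
      have h3 : HasFDerivAt (fun z => P z ξ) ((fderiv ℝ P (χ y)).flip ξ) (χ y) :=
        (ContinuousLinearMap.apply ℝ F ξ).hasFDerivAt.comp (χ y) hPy.hasFDerivAt
      exact h3.hasMFDerivAt.comp y hχd.hasMFDerivAt
    have h2 : mvfderiv 𝓘(ℝ, E) (fun y' => P (χ y') ξ) y u =
        fderiv ℝ P (χ y) (mfderiv 𝓘(ℝ, E) 𝓘(ℝ, E) χ y u) ξ := DFunLike.congr_fun h1.mfderiv _
    have h4 := hΓ' y ⟨hy.1, hUe y hy⟩ (mfderiv 𝓘(ℝ, E) 𝓘(ℝ, E) χ y u) (P (χ y) ξ)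
    rw [chartField_mfderiv hy.1] at h4
    have h5 := A.conn.frame_apply (φ := fun y' => e.symmₗ ℝ y')
      (fun ξ => (hed y hy ξ).mdifferentiableAt (by simp)) h1.mdifferentiableAt u
    refine h5.trans ?_
    have h6 : fderiv ℝ P (χ y) (mfderiv 𝓘(ℝ, E) 𝓘(ℝ, E) χ y u) ξ =
        -Γ (χ y) (mfderiv 𝓘(ℝ, E) 𝓘(ℝ, E) χ y u) (P (χ y) ξ) :=
      DFunLike.congr_fun ((hP' _ hy.2).2 (mfderiv 𝓘(ℝ, E) 𝓘(ℝ, E) χ y u)) ξ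
    rw [h4, h2, h6, map_neg, neg_add_cancel]
    rfl

end CartanAlgebroid

end ConnectionForm

/-! ### The main theorem -/

/-- A flat connection makes a Cartan algebroid locally symmetric. -/
theorem CartanAlgebroid.IsFlat.isLocallySymmetric {E : Type*} [NormedAddCommGroup E]
    [NormedSpace ℝ E] [FiniteDimensional ℝ E]
    {M : Type*} [TopologicalSpace M] [T2Space M] [ChartedSpace E M] [IsManifold 𝓘(ℝ, E) ∞ M]
    {F : Type*} [NormedAddCommGroup F] [NormedSpace ℝ F] [FiniteDimensional ℝ F]
    {V : M → Type*} [TopologicalSpace (TotalSpace F V)] [∀ x, TopologicalSpace (V x)]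
    [FiberBundle F V] [∀ x, AddCommGroup (V x)] [∀ x, Module ℝ (V x)] [VectorBundle ℝ F V]
    [ContMDiffVectorBundle ∞ F V 𝓘(ℝ, E)]
    [∀ x, IsTopologicalAddGroup (V x)] [∀ x, ContinuousSMul ℝ (V x)]
    {A : CartanAlgebroid E F V} (hA : A.IsFlat) : A.IsLocallySymmetric := by
  have : LocallyPathConnectedSpace M := ChartedSpace.locallyPathConnectedSpace E M
  intro x
  obtain ⟨U, hU, hx, φ, hφ⟩ := hA.exists_isParallelFrameOn x
  -- Constancy of the brackets needs a connected domain; components of open sets are open since `M`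
  -- is locally path connected.
  exact ⟨connectedComponentIn U x, hU.connectedComponentIn, mem_connectedComponentIn hx,
    isSymmetricOn_of_isParallelFrameOn
      ((hφ.mono (connectedComponentIn_subset U x)).comp_equiv
        (Module.finBasis ℝ F).equivFun.symm)
      hU.connectedComponentIn isPreconnected_connectedComponentIn (mem_connectedComponentIn hx)⟩

theorem theoremA {E : Type*} [NormedAddCommGroup E] [NormedSpace ℝ E] [FiniteDimensional ℝ E]
    {M : Type*} [TopologicalSpace M] [T2Space M] [ChartedSpace E M] [IsManifold 𝓘(ℝ, E) ∞ M]
    {F : Type*} [NormedAddCommGroup F] [NormedSpace ℝ F] [FiniteDimensional ℝ F]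
    {V : M → Type*} [TopologicalSpace (TotalSpace F V)] [∀ x, TopologicalSpace (V x)]
    [FiberBundle F V] [∀ x, AddCommGroup (V x)] [∀ x, Module ℝ (V x)] [VectorBundle ℝ F V]
    [ContMDiffVectorBundle ∞ F V 𝓘(ℝ, E)]
    [∀ x, IsTopologicalAddGroup (V x)] [∀ x, ContinuousSMul ℝ (V x)]
    (A : CartanAlgebroid E F V) :
    (A.IsLocallySymmetric ↔ A.IsFlat) ∧
    (SimplyConnectedSpace M → A.IsLocallySymmetric →
      A.IsSymmetric ∧
      ∃ _ : Module.Finite ℝ A.parallelSections,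
        A.IsActionIsoOn A.parallelAction A.parallelEval) := by
  -- Local frames modelled on the single space `F` serve both the flatness argument and the global
  -- continuation.
  have key : A.IsLocallySymmetric → ∀ x : M, ∃ U : Set M, IsOpen U ∧ x ∈ U ∧
      ∃ φ : Π x : M, F →ₗ[ℝ] V x, IsParallelFrameOn A.conn φ U := fun h x => by
    obtain ⟨U, hU, hx, hA⟩ := h x
    exact ⟨U, hU, hx, hA.exists_isParallelFrameOn hx⟩
  exact ⟨⟨fun h => A.isFlat_of_isParallelFrameOn (key h), fun h => h.isLocallySymmetric⟩,
    fun _ h => CartanAlgebroid.isSymmetric_of_surjective (key h)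
      (CartanAlgebroid.parallelEval_surjective (key h))⟩
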